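/- Setting. Consider a human-robot interaction model with finite sets $X$ (states), $A^R$ (robot actions), $A^H$ (human actions) and $\Theta$ (intentions), transition probabilities $P(x'\mid x,a,h)$, a human policy $P(h\mid x,\theta)$, robot rewards $r(x,a,h)$ with $|r|\le R$, and a discount factor $\gamma\in[0,1)$. The intention $\theta$ is static and hidden. The state $x$ is fully observed; it includes the bounded history of joint actions if the human policy depends on one. For a belief $b$ (a probability vector on $\Theta$) put $$r(b,x,a)=\sum_{\theta}b(\theta)\sum_{h}P(h\mid x,\theta)\,r(x,a,h),\qquad P(x'\mid b,x,a)=\sum_\theta b(\theta)\sum_h P(h\mid x,\theta)P(x'\mid x,a,h),$$ let $\tau(b,x,a,x')$ be the belief obtained from $b$ by Bayes' rule after doing $a$ in $x$ and arriving at $x'$, and let $r^B(b,x,a)=\sum_{x'}P(x'\mid b,x,a)\,\|\tau(b,x,a,x')-b\|_1$. Let $V^*$ be the Bayes-optimal value function, i.e. the bounded solution of $$V^*(b,x)=\max_a\Big\{r(b,x,a)+\sum_{x'}\gamma P(x'\mid b,x,a)\,V^*(\tau(b,x,a,x'),x')\Big\}.$$ Let $p^G:X\times A^R\to[0,1]$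 be a guidance function with minimal value $\phi=\min p^G(x,a)>0$ (in the application it is learned from demonstrations), let $\beta\ge 0$, and for each belief $b$ let $\tilde V^G(b,\cdot)$ be the solution of $$\tilde V^G(b,x)=\max_a\Big\{\beta\,p^G(x,a)\,r^B(b,x,a)+r(b,x,a)+\sum_{x'}\gamma P(x'\mid b,x,a)\,\tilde V^G(b,x')\Big\},$$ in which the belief is not updated. The algorithm $\mathcal A$ plays at each time $t$ an action attaining this maximum at the current belief and state $(b_t,x_t)$, and then updates its belief by $b_{t+1}=\tau(b_t,x_t,a_t,x_{t+1})$. Let $V^{\mathcal A}(b,x)$ be the expected total discounted reward of the algorithm started from belief $b$ and state $x$. The algorithm is run from an initial belief $b_0$ and an initial state $x_0$, the intention being drawn from $b_0$. Theorem. For all constants $R$ and $C$ there is a polynomial $m$ in six variables, depending only on $R$ and $C$, such that the following holds for every such model, guidance function, initial belief and initial state. If $\beta$ is of order $\frac{|X|^2|A^R|}{\phi(1-\gamma)^2}$, namely $$R\cdot\frac{|X|^2|A^R|}{\phi(1-\gamma)^2}\le\beta\le C\cdot\frac{|X|^2|A^R|}{\phi(1-\gamma)^2},$$ then for all $\delta>0$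 and $\epsilon>0$, with probability at least $1-\delta$, the inequality $$V^{\mathcal A}(b_t,x_t)\ \ge\ V^*(b_t,x_t)-4\epsilon$$ holds for all but at most $m\big(|X|,|A^R|,\tfrac1\epsilon,\tfrac1\delta,\tfrac1{1-\gamma},\tfrac1\phi\big)$ time steps $t$. In particular, for a fixed $\phi$ the number of exceptional time steps is polynomial in $|X|$, $|A^R|$, $\tfrac1\epsilon$, $\tfrac1\delta$ and $\tfrac1{1-\gamma}$. -/

import Mathlib

open MeasureTheory

namespace GuidedExploration

noncomputable section

/-! ### Discounted optimality equation -/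

/-- `V` is a bounded solution of the optimality equation
`V s = max_a { r s a + ∑ₓ γ p(x | s, a) V(next s a x) }`. -/
def SolvesBellman {S A X : Type*} [Fintype X] (γ : ℝ) (r : S → A → ℝ) (p : S → A → X → ℝ)
    (next : S → A → X → S) (V : S → ℝ) : Prop :=
  (∃ K : ℝ, ∀ s, |V s| ≤ K) ∧
    ∀ s, V s = ⨆ a, (r s a + ∑ x, γ * p s a x * V (next s a x))

theorem abs_ciSup_sub_ciSup_le {A : Type*} [Finite A] [Nonempty A] {f g : A → ℝ} {c : ℝ}
    (h : ∀ a, |f a - g a| ≤ c) : |(⨆ a, f a) - ⨆ a, g a| ≤ c := by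
  have hf : BddAbove (Set.range f) := (Set.finite_range f).bddAbove
  have hg : BddAbove (Set.range g) := (Set.finite_range g).bddAbove
  rw [abs_le]
  constructor
  · have : (⨆ a, g a) ≤ (⨆ a, f a) + c := ciSup_le fun a => by
      have h1 := (abs_le.1 (h a)).1
      have h2 := le_ciSup hf a
      linarith
    linarith
  · have : (⨆ a, f a) ≤ (⨆ a, g a) + c := ciSup_le fun a => by
      have h1 := (abs_le.1 (h a)).2
      have h2 := le_ciSup hg a
      linarith
    linarith

theorem abs_backup_sub_le {S A X : Type*} [Fintype A] [Nonempty A] [Fintype X] {γ : ℝ}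
    (hγ : 0 ≤ γ) (r : S → A → ℝ) {p : S → A → X → ℝ} (hp : ∀ s a x, 0 ≤ p s a x)
    (hp1 : ∀ s a, ∑ x, p s a x = 1) (next : S → A → X → S) {V W : S → ℝ} {d : ℝ}
    (h : ∀ s, |V s - W s| ≤ d) (s : S) :
    |(⨆ a, (r s a + ∑ x, γ * p s a x * V (next s a x))) -
      ⨆ a, (r s a + ∑ x, γ * p s a x * W (next s a x))| ≤ γ * d := by
  refine abs_ciSup_sub_ciSup_le fun a => ?_
  have e : (r s a + ∑ x, γ * p s a x * V (next s a x)) -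
      (r s a + ∑ x, γ * p s a x * W (next s a x)) =
      ∑ x, γ * p s a x * (V (next s a x) - W (next s a x)) := by
    rw [add_sub_add_left_eq_sub, ← Finset.sum_sub_distrib]
    exact Finset.sum_congr rfl fun x _ => by ring
  rw [e]
  calc |∑ x, γ * p s a x * (V (next s a x) - W (next s a x))|
      ≤ ∑ x, |γ * p s a x * (V (next s a x) - W (next s a x))| :=
        Finset.abs_sum_le_sum_abs _ _
    _ ≤ ∑ x, γ * p s a x * d := Finset.sum_le_sum fun x _ => by
        rw [abs_mul, abs_of_nonneg (mul_nonneg hγ (hp s a x))]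
        exact mul_le_mul_of_nonneg_left (h _) (mul_nonneg hγ (hp s a x))
    _ = γ * d := by rw [← Finset.sum_mul, ← Finset.mul_sum, hp1, mul_one]

/-- With bounded rewards and a discount factor in `[0, 1)` the optimality equation has exactly one
bounded solution. -/
theorem existsUnique_solvesBellman {S A X : Type*} [Fintype A] [Nonempty A] [Fintype X] {γ : ℝ}
    (hγ : 0 ≤ γ) (hγ1 : γ < 1) {r : S → A → ℝ} (hr : ∃ B : ℝ, ∀ s a, |r s a| ≤ B)
    {p : S → A → X → ℝ} (hp : ∀ s a x, 0 ≤ p s a x)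
    (hp1 : ∀ s a, ∑ x, p s a x = 1) (next : S → A → X → S) :
    ∃! V : S → ℝ, SolvesBellman γ r p next V := by
  obtain ⟨B, hB⟩ := hr
  let _ : TopologicalSpace S := ⊥
  have : DiscreteTopology S := ⟨rfl⟩
  have hbd : ∀ V : BoundedContinuousFunction S ℝ, ∀ s,
      ‖⨆ a, (r s a + ∑ x, γ * p s a x * V (next s a x))‖ ≤ B + γ * ‖V‖ := by
    intro V s
    have h1 := abs_backup_sub_le hγ r hp hp1 next (V := V) (W := fun _ => 0) (d := ‖V‖)
      (fun s => by simpa using V.norm_coe_le_norm s) s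
    have h2 := abs_ciSup_sub_ciSup_le (f := r s) (g := fun _ => (0 : ℝ)) (c := B)
      (fun a => by simpa using hB s a)
    simp only [mul_zero, Finset.sum_const_zero, add_zero] at h1
    rw [ciSup_const, sub_zero] at h2
    rw [Real.norm_eq_abs]
    have h3 := abs_sub_abs_le_abs_sub (⨆ a, (r s a + ∑ x, γ * p s a x * V (next s a x)))
      (⨆ a, r s a)
    linarith
  let F : BoundedContinuousFunction S ℝ → BoundedContinuousFunction S ℝ := fun V =>
    BoundedContinuousFunction.ofNormedAddCommGroupDiscrete
      (fun s => ⨆ a, (r s a + ∑ x, γ * p s a x * V (next s a x))) (B + γ * ‖V‖) (hbd V)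
  have hF : ContractingWith ⟨γ, hγ⟩ F := by
    refine ⟨by exact_mod_cast hγ1, LipschitzWith.of_dist_le_mul fun V W => ?_⟩
    refine (BoundedContinuousFunction.dist_le (mul_nonneg hγ dist_nonneg)).2 fun s => ?_
    rw [Real.dist_eq]
    exact abs_backup_sub_le hγ r hp hp1 next
      (fun s => by rw [← Real.dist_eq]; exact BoundedContinuousFunction.dist_coe_le_dist s) s
  obtain ⟨V, hV, -⟩ := hF.exists_fixedPoint 0 (edist_ne_top _ _)
  refine ⟨V, ⟨⟨_, fun s => V.norm_coe_le_norm s⟩, fun s => ?_⟩, ?_⟩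
  · exact (DFunLike.congr_fun hV s).symm
  · rintro W ⟨⟨K, hK⟩, hW⟩
    let W' : BoundedContinuousFunction S ℝ :=
      BoundedContinuousFunction.ofNormedAddCommGroupDiscrete W K hK
    have hW' : Function.IsFixedPt F W' :=
      BoundedContinuousFunction.ext fun s => (hW s).symm
    have h := hF.fixedPoint_unique' hW' hV
    exact congrArg (fun U : BoundedContinuousFunction S ℝ => (U : S → ℝ)) h

/-! ### The intention POMDP-lite -/

/-- A discounted human-robot interaction model with finite sets of states `X`, robot actions `AR`,
human actions `AH` and (static, hidden) intentions `Θ`. The state is everything the robot observes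
and the dynamics depend on; when the human also reacts to the last `k` joint actions, these are
components of the state. The human's own reward only matters through the human policy. -/
structure Model (X AR AH Θ : Type*) [Fintype X] [Fintype AH] where
  /-- `trans x a h x' = P(x' | x, a, h)` -/
  trans : X → AR → AH → X → ℝ
  trans_nonneg : ∀ x a h x', 0 ≤ trans x a h x'
  trans_sum : ∀ x a h, ∑ x', trans x a h x' = 1
  /-- `human x θ h` is the probability that a human with intention `θ` does `h` in state `x` -/
  human : X → Θ → AH → ℝ
  human_nonneg : ∀ x θ h, 0 ≤ human x θ h
  human_sum : ∀ x θ, ∑ h, human x θ h = 1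
  /-- the robot's reward -/
  reward : X → AR → AH → ℝ
  /-- the discount factor -/
  disc : ℝ
  disc_nonneg : 0 ≤ disc
  disc_lt_one : disc < 1

/-- Beliefs over the intention: probability vectors. -/
abbrev Belief (Θ : Type*) [Fintype Θ] : Type _ := stdSimplex ℝ Θ

namespace Model

variable {X AR AH Θ : Type*} [Fintype X] [Fintype AR] [Fintype AH] [Fintype Θ]
  (M : Model X AR AH Θ)

/-- `P(x' | θ, x, a)`, the human action being averaged out -/
def lik (θ : Θ) (x : X) (a : AR) (x' : X) : ℝ :=
  ∑ h, M.human x θ h * M.trans x a h x'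

/-- mean transition function `P(x' | b, x, a)` -/
def meanTrans (b : Belief Θ) (x : X) (a : AR) (x' : X) : ℝ :=
  ∑ θ, b.1 θ * M.lik θ x a x'

/-- mean reward function `r(b, x, a)` -/
def meanReward (b : Belief Θ) (x : X) (a : AR) : ℝ :=
  ∑ θ, b.1 θ * ∑ h, M.human x θ h * M.reward x a h

theorem lik_nonneg (θ : Θ) (x : X) (a : AR) (x' : X) : 0 ≤ M.lik θ x a x' :=
  Finset.sum_nonneg fun _ _ => mul_nonneg (M.human_nonneg _ _ _) (M.trans_nonneg _ _ _ _)

theorem meanTrans_nonneg (b : Belief Θ) (x : X) (a : AR) (x' : X) :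
    0 ≤ M.meanTrans b x a x' :=
  Finset.sum_nonneg fun θ _ => mul_nonneg (b.2.1 θ) (M.lik_nonneg θ x a x')

theorem lik_sum (θ : Θ) (x : X) (a : AR) : ∑ x', M.lik θ x a x' = 1 := by
  unfold lik
  rw [Finset.sum_comm]
  simp_rw [← Finset.mul_sum, M.trans_sum, mul_one]
  exact M.human_sum x θ

theorem meanTrans_sum (b : Belief Θ) (x : X) (a : AR) : ∑ x', M.meanTrans b x a x' = 1 := by
  unfold meanTrans
  rw [Finset.sum_comm]
  simp_rw [← Finset.mul_sum, M.lik_sum, mul_one]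
  exact b.2.2

open Classical in
/-- Bayes' rule `τ`: the belief after doing `a` in `x` and arriving at `x'`. Arrivals of probability
zero leave the belief unchanged. -/
def update (b : Belief Θ) (x : X) (a : AR) (x' : X) : Belief Θ :=
  if h : M.meanTrans b x a x' = 0 then b
  else ⟨fun θ => b.1 θ * M.lik θ x a x' / M.meanTrans b x a x',
    fun θ => div_nonneg (mul_nonneg (b.2.1 θ) (M.lik_nonneg θ x a x'))
      (M.meanTrans_nonneg b x a x'),
    by rw [← Finset.sum_div]; exact div_self h⟩

theorem exists_abs_meanReward_le : ∃ B : ℝ, ∀ (s : Belief Θ × X) (a : AR),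
    |M.meanReward s.1 s.2 a| ≤ B := by
  refine ⟨∑ x, ∑ a, ∑ h, |M.reward x a h|, fun s a => ?_⟩
  have key : ∀ θ, |∑ h, M.human s.2 θ h * M.reward s.2 a h| ≤
      ∑ x, ∑ a, ∑ h, |M.reward x a h| := by
    intro θ
    calc |∑ h, M.human s.2 θ h * M.reward s.2 a h|
        ≤ ∑ h, |M.human s.2 θ h * M.reward s.2 a h| := Finset.abs_sum_le_sum_abs _ _
      _ ≤ ∑ h, |M.reward s.2 a h| := Finset.sum_le_sum fun h _ => by
          rw [abs_mul, abs_of_nonneg (M.human_nonneg _ _ _)]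
          refine mul_le_of_le_one_left (abs_nonneg _) ?_
          rw [← M.human_sum s.2 θ]
          exact Finset.single_le_sum (fun i _ => M.human_nonneg s.2 θ i) (Finset.mem_univ h)
      _ ≤ ∑ a, ∑ h, |M.reward s.2 a h| :=
          Finset.single_le_sum (f := fun a => ∑ h, |M.reward s.2 a h|)
            (fun _ _ => Finset.sum_nonneg fun _ _ => abs_nonneg _) (Finset.mem_univ a)
      _ ≤ ∑ x, ∑ a, ∑ h, |M.reward x a h| :=
          Finset.single_le_sum (f := fun x => ∑ a, ∑ h, |M.reward x a h|)
            (fun _ _ => Finset.sum_nonneg fun _ _ => Finset.sum_nonneg fun _ _ => abs_nonneg _)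
            (Finset.mem_univ s.2)
  unfold meanReward
  calc |∑ θ, s.1.1 θ * ∑ h, M.human s.2 θ h * M.reward s.2 a h|
      ≤ ∑ θ, |s.1.1 θ * ∑ h, M.human s.2 θ h * M.reward s.2 a h| :=
        Finset.abs_sum_le_sum_abs _ _
    _ ≤ ∑ θ, s.1.1 θ * ∑ x, ∑ a, ∑ h, |M.reward x a h| := Finset.sum_le_sum fun θ _ => by
        rw [abs_mul, abs_of_nonneg (s.1.2.1 θ)]
        exact mul_le_mul_of_nonneg_left (key θ) (s.1.2.1 θ)
    _ = _ := by rw [← Finset.sum_mul, s.1.2.2, one_mul]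

theorem existsUnique_bayesValue [Nonempty AR] :
    ∃! V : Belief Θ × X → ℝ, SolvesBellman M.disc
      (fun s a => M.meanReward s.1 s.2 a) (fun s a x' => M.meanTrans s.1 s.2 a x')
      (fun s a x' => (M.update s.1 s.2 a x', x')) V :=
  existsUnique_solvesBellman M.disc_nonneg M.disc_lt_one M.exists_abs_meanReward_le
    (fun s a x' => M.meanTrans_nonneg s.1 s.2 a x') (fun s a => M.meanTrans_sum s.1 s.2 a) _

/-- The Bayes-optimal value function `V*(b, x)`: the unique bounded solution of
`V*(b, x) = max_a { r(b, x, a) + ∑_{x'} γ P(x' | b, x, a) V*(τ(b, x, a, x'), x') }`. -/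
def bayesValue [Nonempty AR] (b : Belief Θ) (x : X) : ℝ :=
  M.existsUnique_bayesValue.choose (b, x)

/-- The reward bonus `r^B(b, x, a)`: the expected `L¹` distance between consecutive beliefs. -/
def bonus (b : Belief Θ) (x : X) (a : AR) : ℝ :=
  ∑ x', M.meanTrans b x a x' * ∑ θ, |(M.update b x a x').1 θ - b.1 θ|

theorem existsUnique_guidedValue [Nonempty AR] (β : ℝ) (pG : X → AR → ℝ) (b : Belief Θ) :
    ∃! V : X → ℝ, SolvesBellman M.disc
      (fun x a => β * pG x a * M.bonus b x a + M.meanReward b x a)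
      (fun x a x' => M.meanTrans b x a x') (fun _ _ x' => x') V := by
  refine existsUnique_solvesBellman M.disc_nonneg M.disc_lt_one ?_
    (fun x a x' => M.meanTrans_nonneg b x a x') (fun x a => M.meanTrans_sum b x a) _
  obtain ⟨B, hB⟩ := (Set.finite_range fun z : X × AR =>
    |β * pG z.1 z.2 * M.bonus b z.1 z.2 + M.meanReward b z.1 z.2|).bddAbove
  exact ⟨B, fun x a => hB ⟨(x, a), rfl⟩⟩

/-- The value function with guided exploration bonus, the belief being frozen: the unique solution of
`V(b, x) = max_a { β p^G(x, a) r^B(b, x, a) + r(b, x, a) + ∑_{x'} γ P(x' | b, x, a) V(b, x') }`. -/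
def guidedValue [Nonempty AR] (β : ℝ) (pG : X → AR → ℝ) (b : Belief Θ) (x : X) : ℝ :=
  (M.existsUnique_guidedValue β pG b).choose x

/-- The expression maximized over `a` in the equation of `guidedValue`. -/
def guidedQ [Nonempty AR] (β : ℝ) (pG : X → AR → ℝ) (b : Belief Θ) (x : X) (a : AR) : ℝ :=
  β * pG x a * M.bonus b x a + M.meanReward b x a +
    ∑ x', M.disc * M.meanTrans b x a x' * M.guidedValue β pG b x'

/-- `alg` is a policy of the guided exploration algorithm: at every belief and state it plays a
maximizer for the guided value function of the current belief (ties broken arbitrarily). -/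
def IsGuidedPolicy [Nonempty AR] (β : ℝ) (pG : X → AR → ℝ) (alg : Belief Θ → X → AR) : Prop :=
  ∀ b x a, M.guidedQ β pG b x a ≤ M.guidedQ β pG b x (alg b x)

/-- Expected reward `n` steps ahead, starting from belief `b` and state `x`, when the robot acts by
`pol` and updates its belief by Bayes' rule. -/
def expReward (pol : Belief Θ → X → AR) : ℕ → Belief Θ → X → ℝ
  | 0, b, x => M.meanReward b x (pol b x)
  | n + 1, b, x => ∑ x', M.meanTrans b x (pol b x) x' *
      expReward pol n (M.update b x (pol b x) x') x'

/-- The value of the policy `pol`: the expected total discounted reward from belief `b`, state `x`. -/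
def policyValue (pol : Belief Θ → X → AR) (b : Belief Θ) (x : X) : ℝ :=
  ∑' n, M.disc ^ n * M.expReward pol n b x

/-- The belief at time `t` along the state trajectory `ξ`. -/
def beliefAt (pol : Belief Θ → X → AR) (b₀ : Belief Θ) (ξ : ℕ → X) : ℕ → Belief Θ
  | 0 => b₀
  | t + 1 => M.update (beliefAt pol b₀ ξ t) (ξ t) (pol (beliefAt pol b₀ ξ t) (ξ t)) (ξ (t + 1))

/-- The random intention `θ`, states `x t` and human actions `h t` are a run of the interaction when
the robot acts by `pol`, from state `x₀`, the intention being drawn from the prior belief `b₀`: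
their joint law is, on each finite trajectory from `x₀`,
`b₀(θ) ∏_{i < n} P(h_i | x_i, θ) P(x_{i+1} | x_i, a_i, h_i)` with `a_i = pol(b_i, x_i)`.
(The case `n = 0` gives `x 0 = x₀` almost surely.) -/
structure IsRun (pol : Belief Θ → X → AR) (b₀ : Belief Θ) (x₀ : X)
    {Ω : Type*} [MeasurableSpace Ω] (P : Measure Ω)
    (θ : Ω → Θ) (x : ℕ → Ω → X) (h : ℕ → Ω → AH) : Prop where
  measurable_intention : ∀ ϑ, MeasurableSet {ω | θ ω = ϑ}
  measurable_state : ∀ t ξ, MeasurableSet {ω | x t ω = ξ}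
  measurable_human : ∀ t η, MeasurableSet {ω | h t ω = η}
  law : ∀ (n : ℕ) (ϑ : Θ) (ξ : ℕ → X) (η : ℕ → AH), ξ 0 = x₀ →
    P {ω | θ ω = ϑ ∧ (∀ i ≤ n, x i ω = ξ i) ∧ ∀ i < n, h i ω = η i} =
      ENNReal.ofReal (b₀.1 ϑ * ∏ i ∈ Finset.range n,
        (M.human (ξ i) ϑ (η i) *
          M.trans (ξ i) (pol (M.beliefAt pol b₀ ξ i) (ξ i)) (η i) (ξ (i + 1))))

/-- The order of magnitude `|X|² |A^R| / (φ (1 - γ)²)` of the exploration constant. -/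
def bonusScale (φ : ℝ) : ℝ :=
  (Fintype.card X : ℝ) ^ 2 * Fintype.card AR / (φ * (1 - M.disc) ^ 2)

end Model

end

end GuidedExploration

/-!
The proof bounds the expected number of steps with a large loss by a polynomial that does not see the
number of intentions, and concludes by Markov's inequality.

*The loss is paid by the bonus.* `V*` is `R / (1 - γ)`-Lipschitz in the belief for the `L¹` distance
(`abs_bayesValue_sub_le`), so a bonus with coefficient at least `R / (1 - γ)` compensates for freezing
the belief, and the guided value function is optimistic (`bayesValue_le_guidedValue`). The guided value
is Lipschitz in the belief too (`abs_guidedValue_sub_le`), so its excess `G` over the value of the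
algorithm satisfies `G ≤ K r^B + γ E[G at the next step]`, with `K` polynomial in the parameters
(`guidedValue_sub_policyValue_le`).

*The bonuses are summable in fourth power.* The bonus `r^B(b, x, a)` is the mean absolute deviation
under `b` of the unknown probabilities `P(y | x, a, θ)`. Let `v_y` be the variance of
`P(y | x, a, θ)` under `b`. A transition from `x` under `a` decreases `v_y` by at least `v_y ^ 2` on
average, and no transition increases the variance of any unknown probability on average. Hence the sum
of all variances, which is at most `|X|² |A^R|`, is a potential: the expected sum over all times of
`∑_y v_y ^ 2`, and with it that of `(r^B) ^ 4 ≤ |X|³ ∑_y v_y ^ 2`, is bounded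
(`sum_iterate_stepMean_bonus_pow_le`).

*Counting.* Bonuses below `ε (1 - γ) / K` contribute at most `ε` to `G`; larger ones are bounded by a
multiple of their fourth power. So the expected sum over all times of `max (G - ε) 0` is bounded, and
with it the expected number of times with `G > 4 ε` (`sum_iterate_stepMean_largeLoss_le`). The
transition operator `stepMean` of the process of beliefs and states carries these expectations;
`IsRun.measure_mem_le` links it to the law of a run.
-/

set_option linter.unusedSectionVars false

namespace GuidedExploration

noncomputable section

/-! ### Auxiliary inequalities -/

theorem abs_sum_mul_le {ι : Type*} [Fintype ι] {w q : ι → ℝ} {c : ℝ} (hq : ∀ i, |q i| ≤ c) :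
    |∑ i, w i * q i| ≤ c * ∑ i, |w i| := by
  rw [Finset.mul_sum]
  refine (Finset.abs_sum_le_sum_abs _ _).trans (Finset.sum_le_sum fun i _ => ?_)
  rw [abs_mul, mul_comm]
  exact mul_le_mul_of_nonneg_right (hq i) (abs_nonneg _)

/-- The contraction argument on a finite set: a function whose upper bounds `D` improve to
`c + γ D` is at most the fixed point `c / (1 - γ)`. -/
theorem le_div_of_contracting {X : Type*} [Finite X] {f : X → ℝ} {c γ : ℝ} (hγ : γ < 1)
    (h : ∀ D, (∀ x, f x ≤ D) → ∀ x, f x ≤ c + γ * D) (x : X) : f x ≤ c / (1 - γ) := by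
  have : Nonempty X := ⟨x⟩
  obtain ⟨y, hy⟩ := Finite.exists_max f
  have h1 := h (f y) hy y
  refine (hy x).trans ?_
  rw [le_div_iff₀ (by linarith)]
  linarith

namespace Model

variable {X AR AH Θ : Type*} [Fintype X] [Fintype AR] [Fintype AH] [Fintype Θ]
  (M : Model X AR AH Θ)

/-! ### One step of the belief process -/

theorem mul_lik_eq_zero {b : Belief Θ} {x : X} {a : AR} {x' : X}
    (h : M.meanTrans b x a x' = 0) (θ : Θ) : b.1 θ * M.lik θ x a x' = 0 :=
  (Finset.sum_eq_zero_iff_of_nonneg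
    fun θ _ => mul_nonneg (b.2.1 θ) (M.lik_nonneg θ x a x')).1 h θ (Finset.mem_univ θ)

/-- Bayes' rule without division; it also covers arrivals of probability zero. -/
theorem meanTrans_mul_update (b : Belief Θ) (x : X) (a : AR) (x' : X) (θ : Θ) :
    M.meanTrans b x a x' * (M.update b x a x').1 θ = b.1 θ * M.lik θ x a x' := by
  by_cases h : M.meanTrans b x a x' = 0
  · rw [M.mul_lik_eq_zero h, h, zero_mul]
  · rw [update, dif_neg h]
    exact mul_div_cancel₀ _ h

theorem lik_le_one (θ : Θ) (x : X) (a : AR) (x' : X) : M.lik θ x a x' ≤ 1 := by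
  rw [← M.lik_sum θ x a]
  exact Finset.single_le_sum (fun y _ => M.lik_nonneg θ x a y) (Finset.mem_univ x')

theorem meanTrans_le_one (b : Belief Θ) (x : X) (a : AR) (x' : X) :
    M.meanTrans b x a x' ≤ 1 := by
  rw [← M.meanTrans_sum b x a]
  exact Finset.single_le_sum (fun y _ => M.meanTrans_nonneg b x a y) (Finset.mem_univ x')

theorem abs_human_reward_le {R : ℝ} (hR : ∀ y a k, |M.reward y a k| ≤ R) (x : X) (a : AR)
    (θ : Θ) : |∑ h, M.human x θ h * M.reward x a h| ≤ R := by
  refine (abs_sum_mul_le (w := M.human x θ) (q := M.reward x a) (hR x a)).trans_eq ?_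
  simp_rw [abs_of_nonneg (M.human_nonneg x θ _), M.human_sum, mul_one]

theorem abs_meanReward_le {R : ℝ} (hR : ∀ y a k, |M.reward y a k| ≤ R) (b : Belief Θ) (x : X)
    (a : AR) : |M.meanReward b x a| ≤ R := by
  refine (abs_sum_mul_le (M.abs_human_reward_le hR x a)).trans_eq ?_
  simp_rw [abs_of_nonneg (b.2.1 _)]
  rw [b.2.2, mul_one]

theorem nonneg_of_abs_reward_le [Nonempty AR] {R : ℝ} (hR : ∀ y a k, |M.reward y a k| ≤ R)
    (b : Belief Θ) (x : X) : 0 ≤ R :=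
  (abs_nonneg _).trans (M.abs_meanReward_le hR b x (Classical.arbitrary AR))

/-! ### Lipschitz continuity of the Bayes-optimal value -/

section Bayes

variable [Nonempty AR]

theorem bayesValue_eq (b : Belief Θ) (x : X) : M.bayesValue b x =
    ⨆ a, (M.meanReward b x a +
      ∑ x', M.disc * M.meanTrans b x a x' * M.bayesValue (M.update b x a x') x') :=
  M.existsUnique_bayesValue.choose_spec.1.2 (b, x)

theorem exists_abs_bayesValue_le :
    ∃ B : ℝ, ∀ (b : Belief Θ) (x : X), |M.bayesValue b x| ≤ B := by
  obtain ⟨B, hB⟩ := M.existsUnique_bayesValue.choose_spec.1.1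
  exact ⟨B, fun b x => hB (b, x)⟩

/-- The positively homogeneous extension `p b ↦ p V*(b, x)` of the value function to unnormalized
beliefs is `R / (1 - γ)`-Lipschitz up to an error that decays geometrically. Unnormalized beliefs
make the induction work: there Bayes' rule is multiplication by the likelihood, which is a
contraction in `L¹` after summing over the arrivals. -/
theorem abs_mul_bayesValue_sub_le {R B : ℝ} (hR : ∀ y a k, |M.reward y a k| ≤ R)
    (hB : ∀ (b : Belief Θ) (x : X), |M.bayesValue b x| ≤ B) (n : ℕ) :
    ∀ (b b' : Belief Θ) (x : X) (p p' : ℝ), 0 ≤ p → 0 ≤ p' →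
      |p * M.bayesValue b x - p' * M.bayesValue b' x| ≤
        R / (1 - M.disc) * ∑ θ, |p * b.1 θ - p' * b'.1 θ| + M.disc ^ n * (B * (p + p')) := by
  have hγ := M.disc_nonneg
  have hγ1 : 0 < 1 - M.disc := sub_pos.2 M.disc_lt_one
  induction n with
  | zero =>
    intro b b' x p p' hp hp'
    have hR0 := M.nonneg_of_abs_reward_le hR b x
    have h1 : |p * M.bayesValue b x - p' * M.bayesValue b' x| ≤ p * B + p' * B := by
      refine (abs_sub _ _).trans ?_
      rw [abs_mul, abs_mul, abs_of_nonneg hp, abs_of_nonneg hp']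
      exact add_le_add (mul_le_mul_of_nonneg_left (hB _ _) hp)
        (mul_le_mul_of_nonneg_left (hB _ _) hp')
    have h2 : 0 ≤ R / (1 - M.disc) * ∑ θ, |p * b.1 θ - p' * b'.1 θ| := by positivity
    rw [pow_zero, one_mul]
    linarith
  | succ n ih =>
    intro b b' x p p' hp hp'
    rw [M.bayesValue_eq b, M.bayesValue_eq b', Real.mul_iSup_of_nonneg hp,
      Real.mul_iSup_of_nonneg hp']
    refine abs_ciSup_sub_ciSup_le fun a => ?_
    set S := ∑ θ, |p * b.1 θ - p' * b'.1 θ| with hS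
    have hr : |p * M.meanReward b x a - p' * M.meanReward b' x a| ≤ R * S := by
      have e : p * M.meanReward b x a - p' * M.meanReward b' x a =
          ∑ θ, (p * b.1 θ - p' * b'.1 θ) * ∑ h, M.human x θ h * M.reward x a h := by
        simp only [meanReward, Finset.mul_sum (s := Finset.univ (α := Θ)),
          ← Finset.sum_sub_distrib]
        exact Finset.sum_congr rfl fun θ _ => by ring
      rw [e]
      exact abs_sum_mul_le (M.abs_human_reward_le hR x a)
    have hv : ∑ x', |p * M.meanTrans b x a x' * M.bayesValue (M.update b x a x') x' -
        p' * M.meanTrans b' x a x' * M.bayesValue (M.update b' x a x') x'| ≤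
        R / (1 - M.disc) * S + M.disc ^ n * (B * (p + p')) := by
      have h1 : ∀ x', |p * M.meanTrans b x a x' * M.bayesValue (M.update b x a x') x' -
          p' * M.meanTrans b' x a x' * M.bayesValue (M.update b' x a x') x'| ≤
          R / (1 - M.disc) * ∑ θ, |p * b.1 θ - p' * b'.1 θ| * M.lik θ x a x' +
          M.disc ^ n * (B * (p * M.meanTrans b x a x' + p' * M.meanTrans b' x a x')) := by
        intro x'
        refine (ih _ _ x' _ _ (mul_nonneg hp (M.meanTrans_nonneg b x a x'))
          (mul_nonneg hp' (M.meanTrans_nonneg b' x a x'))).trans_eq ?_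
        congr 2
        refine Finset.sum_congr rfl fun θ _ => ?_
        rw [mul_assoc, mul_assoc, M.meanTrans_mul_update, M.meanTrans_mul_update, ← mul_assoc,
          ← mul_assoc, ← sub_mul, abs_mul, abs_of_nonneg (M.lik_nonneg θ x a x')]
      refine (Finset.sum_le_sum fun x' _ => h1 x').trans_eq ?_
      rw [Finset.sum_add_distrib, ← Finset.mul_sum, Finset.sum_comm]
      simp_rw [← Finset.mul_sum, M.lik_sum, mul_one, Finset.sum_add_distrib, ← Finset.mul_sum,
        M.meanTrans_sum, mul_one]
      rfl
    have e : p * (M.meanReward b x a +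
          ∑ x', M.disc * M.meanTrans b x a x' * M.bayesValue (M.update b x a x') x') -
        p' * (M.meanReward b' x a +
          ∑ x', M.disc * M.meanTrans b' x a x' * M.bayesValue (M.update b' x a x') x') =
        (p * M.meanReward b x a - p' * M.meanReward b' x a) + M.disc *
          ∑ x', (p * M.meanTrans b x a x' * M.bayesValue (M.update b x a x') x' -
            p' * M.meanTrans b' x a x' * M.bayesValue (M.update b' x a x') x') := by
      rw [Finset.sum_sub_distrib, mul_add, mul_add, mul_sub, Finset.mul_sum, Finset.mul_sum,
        Finset.mul_sum, Finset.mul_sum]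
      have e1 : ∀ (q : ℝ) (c : Belief Θ), ∑ x', q * (M.disc * M.meanTrans c x a x' *
          M.bayesValue (M.update c x a x') x') =
          ∑ x', M.disc * (q * M.meanTrans c x a x' * M.bayesValue (M.update c x a x') x') :=
        fun q c => Finset.sum_congr rfl fun _ _ => by ring
      rw [e1, e1]
      ring
    rw [e]
    calc _ ≤ R * S + M.disc * (R / (1 - M.disc) * S + M.disc ^ n * (B * (p + p'))) := by
          refine (abs_add_le _ _).trans (add_le_add hr ?_)
          rw [abs_mul, abs_of_nonneg hγ]
          exact mul_le_mul_of_nonneg_left ((Finset.abs_sum_le_sum_abs _ _).trans hv) hγ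
      _ = _ := by
          field_simp
          ring

theorem abs_bayesValue_sub_le {R : ℝ} (hR : ∀ y a k, |M.reward y a k| ≤ R)
    (b b' : Belief Θ) (x : X) :
    |M.bayesValue b x - M.bayesValue b' x| ≤ R / (1 - M.disc) * ∑ θ, |b.1 θ - b'.1 θ| := by
  obtain ⟨B, hB⟩ := M.exists_abs_bayesValue_le
  have h := fun n => M.abs_mul_bayesValue_sub_le hR hB n b b' x 1 1 zero_le_one zero_le_one
  simp only [one_mul] at h
  have hlim := ((tendsto_pow_atTop_nhds_zero_of_lt_one M.disc_nonneg M.disc_lt_one).mul_const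
    (B * (1 + 1))).const_add (R / (1 - M.disc) * ∑ θ, |b.1 θ - b'.1 θ|)
  rw [zero_mul, add_zero] at hlim
  exact ge_of_tendsto' hlim h

end Bayes

/-! ### The exploration bonus -/

/-- The bonus is the mean absolute deviation, under the belief, of the unknown transition
probabilities. -/
theorem bonus_eq (b : Belief Θ) (x : X) (a : AR) : M.bonus b x a =
    ∑ x', ∑ θ, b.1 θ * |M.lik θ x a x' - M.meanTrans b x a x'| := by
  refine Finset.sum_congr rfl fun x' _ => ?_
  rw [Finset.mul_sum]
  refine Finset.sum_congr rfl fun θ _ => ?_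
  have hp := M.meanTrans_nonneg b x a x'
  calc M.meanTrans b x a x' * |(M.update b x a x').1 θ - b.1 θ|
      = |M.meanTrans b x a x' * ((M.update b x a x').1 θ - b.1 θ)| := by
        rw [abs_mul, abs_of_nonneg hp]
    _ = |b.1 θ * (M.lik θ x a x' - M.meanTrans b x a x')| := by
        rw [mul_sub, M.meanTrans_mul_update, mul_sub, mul_comm (b.1 θ) (M.meanTrans b x a x')]
    _ = _ := by rw [abs_mul, abs_of_nonneg (b.2.1 θ)]

theorem bonus_nonneg (b : Belief Θ) (x : X) (a : AR) : 0 ≤ M.bonus b x a :=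
  Finset.sum_nonneg fun x' _ => mul_nonneg (M.meanTrans_nonneg b x a x')
    (Finset.sum_nonneg fun _ _ => abs_nonneg _)

theorem sum_abs_lik_sub_le (θ : Θ) (b : Belief Θ) (x : X) (a : AR) :
    ∑ x', |M.lik θ x a x' - M.meanTrans b x a x'| ≤ 2 := by
  calc _ ≤ ∑ x', (M.lik θ x a x' + M.meanTrans b x a x') := Finset.sum_le_sum fun x' _ => by
        refine (abs_sub _ _).trans_eq ?_
        rw [abs_of_nonneg (M.lik_nonneg θ x a x'), abs_of_nonneg (M.meanTrans_nonneg b x a x')]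
    _ = 2 := by rw [Finset.sum_add_distrib, M.lik_sum, M.meanTrans_sum]; norm_num

theorem bonus_le_two (b : Belief Θ) (x : X) (a : AR) : M.bonus b x a ≤ 2 := by
  rw [M.bonus_eq, Finset.sum_comm]
  calc _ ≤ ∑ θ, b.1 θ * 2 := Finset.sum_le_sum fun θ _ => by
        rw [← Finset.mul_sum]
        exact mul_le_mul_of_nonneg_left (M.sum_abs_lik_sub_le θ b x a) (b.2.1 θ)
    _ = 2 := by rw [← Finset.sum_mul, b.2.2, one_mul]

theorem sum_abs_meanTrans_sub_le (b b' : Belief Θ) (x : X) (a : AR) :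
    ∑ x', |M.meanTrans b x a x' - M.meanTrans b' x a x'| ≤ ∑ θ, |b.1 θ - b'.1 θ| := by
  calc _ ≤ ∑ x', ∑ θ, |b.1 θ - b'.1 θ| * M.lik θ x a x' := Finset.sum_le_sum fun x' _ => by
        rw [meanTrans, meanTrans, ← Finset.sum_sub_distrib]
        refine (Finset.abs_sum_le_sum_abs _ _).trans_eq (Finset.sum_congr rfl fun θ _ => ?_)
        rw [← sub_mul, abs_mul, abs_of_nonneg (M.lik_nonneg θ x a x')]
    _ = _ := by
        rw [Finset.sum_comm]
        simp_rw [← Finset.mul_sum, M.lik_sum, mul_one]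

theorem abs_bonus_sub_le (b b' : Belief Θ) (x : X) (a : AR) :
    |M.bonus b x a - M.bonus b' x a| ≤ 3 * ∑ θ, |b.1 θ - b'.1 θ| := by
  rw [M.bonus_eq, M.bonus_eq, ← Finset.sum_sub_distrib]
  simp_rw [← Finset.sum_sub_distrib]
  have key : ∀ x' θ, |(b.1 θ * |M.lik θ x a x' - M.meanTrans b x a x'| -
      b'.1 θ * |M.lik θ x a x' - M.meanTrans b' x a x'|)| ≤
      |b.1 θ - b'.1 θ| * |M.lik θ x a x' - M.meanTrans b x a x'| +
      b'.1 θ * |M.meanTrans b x a x' - M.meanTrans b' x a x'| := by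
    intro x' θ
    have h1 := abs_abs_sub_abs_le (M.lik θ x a x' - M.meanTrans b x a x')
      (M.lik θ x a x' - M.meanTrans b' x a x')
    rw [sub_sub_sub_cancel_left, abs_sub_comm (M.meanTrans b' x a x')] at h1
    calc _ = |(b.1 θ - b'.1 θ) * |M.lik θ x a x' - M.meanTrans b x a x'| + b'.1 θ *
          (|M.lik θ x a x' - M.meanTrans b x a x'| -
            |M.lik θ x a x' - M.meanTrans b' x a x'|)| := by congr 1; ring
      _ ≤ _ := by
        refine (abs_add_le _ _).trans ?_
        rw [abs_mul, abs_mul, abs_abs, abs_of_nonneg (b'.2.1 θ)]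
        exact add_le_add le_rfl (mul_le_mul_of_nonneg_left h1 (b'.2.1 θ))
  calc _ ≤ ∑ x', ∑ θ, (|b.1 θ - b'.1 θ| * |M.lik θ x a x' - M.meanTrans b x a x'| +
      b'.1 θ * |M.meanTrans b x a x' - M.meanTrans b' x a x'|) :=
        (Finset.abs_sum_le_sum_abs _ _).trans (Finset.sum_le_sum fun x' _ =>
          (Finset.abs_sum_le_sum_abs _ _).trans (Finset.sum_le_sum fun θ _ => key x' θ))
    _ = ∑ θ, |b.1 θ - b'.1 θ| * ∑ x', |M.lik θ x a x' - M.meanTrans b x a x'| +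
        ∑ x', |M.meanTrans b x a x' - M.meanTrans b' x a x'| := by
        simp_rw [Finset.sum_add_distrib, ← Finset.sum_mul, b'.2.2, one_mul]
        rw [Finset.sum_comm]
        simp_rw [Finset.mul_sum]
    _ ≤ ∑ θ, |b.1 θ - b'.1 θ| * 2 + ∑ θ, |b.1 θ - b'.1 θ| :=
        add_le_add (Finset.sum_le_sum fun θ _ => mul_le_mul_of_nonneg_left
          (M.sum_abs_lik_sub_le θ b x a) (abs_nonneg _)) (M.sum_abs_meanTrans_sub_le b b' x a)
    _ = _ := by rw [← Finset.sum_mul]; ring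

/-! ### The guided value function -/

theorem abs_sum_disc_mul_le (b : Belief Θ) (x : X) (a : AR) {V : X → ℝ} {D : ℝ}
    (hD : ∀ y, |V y| ≤ D) : |∑ x', M.disc * M.meanTrans b x a x' * V x'| ≤ M.disc * D := by
  refine (abs_sum_mul_le hD).trans_eq ?_
  simp_rw [abs_of_nonneg (mul_nonneg M.disc_nonneg (M.meanTrans_nonneg b x a _)),
    ← Finset.mul_sum, M.meanTrans_sum, mul_one]
  exact mul_comm _ _

section Guided

variable [Nonempty AR]

theorem guidedValue_eq (β : ℝ) (pG : X → AR → ℝ) (b : Belief Θ) (x : X) :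
    M.guidedValue β pG b x = ⨆ a, M.guidedQ β pG b x a :=
  (M.existsUnique_guidedValue β pG b).choose_spec.1.2 x

/-- Optimism: a bonus that outweighs the Lipschitz constant of `V*` pays for freezing the
belief. -/
theorem bayesValue_le_guidedValue {R β : ℝ} {pG : X → AR → ℝ}
    (hR : ∀ y a k, |M.reward y a k| ≤ R) (hβ : ∀ y a, R / (1 - M.disc) ≤ β * pG y a)
    (b : Belief Θ) (x : X) : M.bayesValue b x ≤ M.guidedValue β pG b x := by
  have hγ := M.disc_nonneg
  have hL : 0 ≤ R / (1 - M.disc) :=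
    div_nonneg (M.nonneg_of_abs_reward_le hR b x) (sub_pos.2 M.disc_lt_one).le
  have h := le_div_of_contracting (f := fun y => M.bayesValue b y - M.guidedValue β pG b y)
    (c := 0) M.disc_lt_one (fun D hD y => ?_) x
  · rw [zero_div] at h
    linarith
  rw [zero_add, sub_le_iff_le_add, M.bayesValue_eq b y]
  refine ciSup_le fun a => ?_
  have h1 : M.guidedQ β pG b y a ≤ M.guidedValue β pG b y := by
    rw [M.guidedValue_eq]
    exact le_ciSup (Set.finite_range _).bddAbove a
  have h2 : ∑ x', M.disc * M.meanTrans b y a x' * M.bayesValue (M.update b y a x') x' ≤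
      ∑ x', M.disc * M.meanTrans b y a x' * M.guidedValue β pG b x' + M.disc * D +
        M.disc * (R / (1 - M.disc) * M.bonus b y a) := by
    have e : ∑ x', M.disc * M.meanTrans b y a x' * M.guidedValue β pG b x' + M.disc * D +
        M.disc * (R / (1 - M.disc) * M.bonus b y a) =
        ∑ x', M.disc * M.meanTrans b y a x' * (M.guidedValue β pG b x' + D +
          R / (1 - M.disc) * ∑ θ, |(M.update b y a x').1 θ - b.1 θ|) := by
      simp_rw [mul_add, Finset.sum_add_distrib, ← Finset.sum_mul, ← Finset.mul_sum,
        M.meanTrans_sum, mul_one, bonus, Finset.mul_sum]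
      congr 1
      refine Finset.sum_congr rfl fun _ _ => Finset.sum_congr rfl fun _ _ => by ring
    rw [e]
    refine Finset.sum_le_sum fun x' _ => mul_le_mul_of_nonneg_left ?_
      (mul_nonneg hγ (M.meanTrans_nonneg b y a x'))
    have h3 := (abs_le.1 (M.abs_bayesValue_sub_le hR (M.update b y a x') b x')).2
    have h4 := hD x'
    linarith
  have h5 : M.disc * (R / (1 - M.disc) * M.bonus b y a) ≤ β * pG y a * M.bonus b y a :=
    (mul_le_of_le_one_left (mul_nonneg hL (M.bonus_nonneg b y a)) M.disc_lt_one.le).trans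
      (mul_le_mul_of_nonneg_right (hβ y a) (M.bonus_nonneg b y a))
  unfold guidedQ at h1
  linarith

theorem abs_guidedValue_le {R β : ℝ} {pG : X → AR → ℝ} (hR : ∀ y a k, |M.reward y a k| ≤ R)
    (hβ : ∀ y a, |β * pG y a| ≤ β) (b : Belief Θ) (x : X) :
    |M.guidedValue β pG b x| ≤ (2 * β + R) / (1 - M.disc) := by
  refine le_div_of_contracting (f := fun y => |M.guidedValue β pG b y|) M.disc_lt_one
    (fun D hD y => ?_) x
  have h := abs_ciSup_sub_ciSup_le (f := M.guidedQ β pG b y) (g := fun _ => (0 : ℝ))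
    (c := 2 * β + R + M.disc * D) fun a => ?_
  · rwa [ciSup_const, sub_zero, ← M.guidedValue_eq] at h
  have h1 : |β * pG y a * M.bonus b y a| ≤ 2 * β := by
    rw [abs_mul, abs_of_nonneg (M.bonus_nonneg b y a), mul_comm 2]
    exact mul_le_mul (hβ y a) (M.bonus_le_two b y a) (M.bonus_nonneg b y a)
      ((abs_nonneg _).trans (hβ y a))
  have h2 := M.abs_meanReward_le hR b y a
  have h3 := M.abs_sum_disc_mul_le b y a hD
  rw [sub_zero, guidedQ]
  exact (abs_add_three _ _ _).trans (by linarith)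

theorem abs_guidedValue_sub_le {R β : ℝ} {pG : X → AR → ℝ}
    (hR : ∀ y a k, |M.reward y a k| ≤ R) (hβ : ∀ y a, |β * pG y a| ≤ β)
    (b b' : Belief Θ) (x : X) :
    |M.guidedValue β pG b x - M.guidedValue β pG b' x| ≤
      (3 * β + R + (2 * β + R) / (1 - M.disc)) / (1 - M.disc) * ∑ θ, |b.1 θ - b'.1 θ| := by
  set S := ∑ θ, |b.1 θ - b'.1 θ| with hS
  have hS0 : 0 ≤ S := Finset.sum_nonneg fun _ _ => abs_nonneg _
  rw [div_mul_eq_mul_div]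
  refine le_div_of_contracting
    (f := fun y => |M.guidedValue β pG b y - M.guidedValue β pG b' y|) M.disc_lt_one
    (fun D hD y => ?_) x
  rw [M.guidedValue_eq, M.guidedValue_eq]
  refine abs_ciSup_sub_ciSup_le fun a => ?_
  have h1 : |β * pG y a * (M.bonus b y a - M.bonus b' y a)| ≤ β * (3 * S) := by
    rw [abs_mul]
    exact mul_le_mul (hβ y a) (M.abs_bonus_sub_le b b' y a) (abs_nonneg _)
      ((abs_nonneg _).trans (hβ y a))
  have h2 : |M.meanReward b y a - M.meanReward b' y a| ≤ R * S := by
    rw [meanReward, meanReward, ← Finset.sum_sub_distrib]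
    simp_rw [← sub_mul]
    exact abs_sum_mul_le (M.abs_human_reward_le hR y a)
  have h3 := M.abs_sum_disc_mul_le b y a hD
  set W := (2 * β + R) / (1 - M.disc) with hW
  have hW' : ∀ y, |M.guidedValue β pG b' y| ≤ W := M.abs_guidedValue_le hR hβ b'
  have hW0 : 0 ≤ W := (abs_nonneg _).trans (hW' y)
  have h4 : |∑ x', M.disc * (M.meanTrans b y a x' - M.meanTrans b' y a x') *
      M.guidedValue β pG b' x'| ≤ W * S := by
    refine (abs_sum_mul_le hW').trans (mul_le_mul_of_nonneg_left ?_ hW0)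
    refine le_trans (Finset.sum_le_sum fun x' _ => ?_) (M.sum_abs_meanTrans_sub_le b b' y a)
    rw [abs_mul, abs_of_nonneg M.disc_nonneg]
    exact mul_le_of_le_one_left (abs_nonneg _) M.disc_lt_one.le
  have e : M.guidedQ β pG b y a - M.guidedQ β pG b' y a =
      β * pG y a * (M.bonus b y a - M.bonus b' y a) +
      (M.meanReward b y a - M.meanReward b' y a) +
      ∑ x', M.disc * M.meanTrans b y a x' *
        (M.guidedValue β pG b x' - M.guidedValue β pG b' x') +
      ∑ x', M.disc * (M.meanTrans b y a x' - M.meanTrans b' y a x') *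
        M.guidedValue β pG b' x' := by
    simp only [guidedQ, mul_sub, sub_mul, Finset.sum_sub_distrib]
    ring
  rw [e]
  refine (abs_add_le _ _).trans ?_
  have h5 := abs_add_three (β * pG y a * (M.bonus b y a - M.bonus b' y a))
    (M.meanReward b y a - M.meanReward b' y a) (∑ x', M.disc * M.meanTrans b y a x' *
        (M.guidedValue β pG b x' - M.guidedValue β pG b' x'))
  linarith

end Guided

/-! ### The belief process under a policy -/

/-- The transition operator of the Markov process of beliefs and states under `pol`: the conditional
expectation of `f` after one step. -/
def stepMean (pol : Belief Θ → X → AR) (f : Belief Θ → X → ℝ) (b : Belief Θ) (x : X) : ℝ :=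
  ∑ x', M.meanTrans b x (pol b x) x' * f (M.update b x (pol b x) x') x'

variable (pol : Belief Θ → X → AR)

theorem stepMean_mono {f g : Belief Θ → X → ℝ} (h : f ≤ g) :
    M.stepMean pol f ≤ M.stepMean pol g := fun _ _ =>
  Finset.sum_le_sum fun _ _ => mul_le_mul_of_nonneg_left (h _ _) (M.meanTrans_nonneg _ _ _ _)

theorem stepMean_add (f g : Belief Θ → X → ℝ) :
    M.stepMean pol (f + g) = M.stepMean pol f + M.stepMean pol g := by
  funext b x
  simp [stepMean, mul_add, Finset.sum_add_distrib]

theorem stepMean_smul (c : ℝ) (f : Belief Θ → X → ℝ) :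
    M.stepMean pol (c • f) = c • M.stepMean pol f := by
  funext b x
  simp only [stepMean, Pi.smul_apply, smul_eq_mul, Finset.mul_sum]
  exact Finset.sum_congr rfl fun _ _ => by ring

theorem stepMean_const (c : ℝ) : M.stepMean pol (fun _ _ => c) = fun _ _ => c := by
  funext b x
  simp [stepMean, ← Finset.sum_mul, M.meanTrans_sum]

theorem iterate_stepMean_mono (t : ℕ) {f g : Belief Θ → X → ℝ} (h : f ≤ g) :
    (M.stepMean pol)^[t] f ≤ (M.stepMean pol)^[t] g :=
  Monotone.iterate (fun _ _ h => M.stepMean_mono pol h) t h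

theorem iterate_stepMean_add (t : ℕ) (f g : Belief Θ → X → ℝ) :
    (M.stepMean pol)^[t] (f + g) = (M.stepMean pol)^[t] f + (M.stepMean pol)^[t] g := by
  induction t generalizing f g with
  | zero => rfl
  | succ t ih => rw [Function.iterate_succ_apply, stepMean_add, ih]; rfl

theorem iterate_stepMean_smul (t : ℕ) (c : ℝ) (f : Belief Θ → X → ℝ) :
    (M.stepMean pol)^[t] (c • f) = c • (M.stepMean pol)^[t] f := by
  induction t generalizing f with
  | zero => rfl
  | succ t ih => rw [Function.iterate_succ_apply, stepMean_smul, ih]; rfl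

theorem iterate_stepMean_le {f : Belief Θ → X → ℝ} {c : ℝ} (h : ∀ b x, f b x ≤ c) (t : ℕ)
    (b : Belief Θ) (x : X) : (M.stepMean pol)^[t] f b x ≤ c := by
  refine (M.iterate_stepMean_mono pol t (g := fun _ _ => c) h b x).trans_eq ?_
  rw [Function.iterate_fixed (M.stepMean_const pol c)]

theorem iterate_stepMean_nonneg {f : Belief Θ → X → ℝ} (h : ∀ b x, 0 ≤ f b x) (t : ℕ)
    (b : Belief Θ) (x : X) : 0 ≤ (M.stepMean pol)^[t] f b x := by
  refine le_of_eq_of_le ?_ (M.iterate_stepMean_mono pol t (f := fun _ _ => 0) h b x)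
  rw [Function.iterate_fixed (M.stepMean_const pol 0)]

/-- A nonnegative potential that drops by at least `g` in each step on average bounds the total
expected amount of `g`. -/
theorem sum_iterate_stepMean_le {f g : Belief Θ → X → ℝ} (hf : ∀ b x, 0 ≤ f b x)
    (h : g + M.stepMean pol f ≤ f) (T : ℕ) (b : Belief Θ) (x : X) :
    ∑ t ∈ Finset.range T, (M.stepMean pol)^[t] g b x ≤ f b x := by
  have key : ∑ t ∈ Finset.range T, (M.stepMean pol)^[t] g b x +
      (M.stepMean pol)^[T] f b x ≤ f b x := by
    induction T with
    | zero => simp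
    | succ T ih =>
      have h1 := M.iterate_stepMean_mono pol T h b x
      rw [iterate_stepMean_add, Pi.add_apply, Pi.add_apply, ← Function.iterate_succ_apply] at h1
      rw [Finset.sum_range_succ]
      linarith
  have := M.iterate_stepMean_nonneg pol hf T b x
  linarith

/-- If `f` is at most its discounted mean one step later plus `g`, then the total expected amount of
`f` is bounded by that of `g`. -/
theorem sum_iterate_stepMean_le_of_discounted {f g : Belief Θ → X → ℝ} {B G : ℝ}
    (hB : ∀ b x, f b x ≤ B) (hf : ∀ b x, 0 ≤ f b x)
    (h : f ≤ g + M.disc • M.stepMean pol f) (b : Belief Θ) (x : X) (T : ℕ)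
    (hG : ∑ t ∈ Finset.range T, (M.stepMean pol)^[t] g b x ≤ G) :
    ∑ t ∈ Finset.range T, (M.stepMean pol)^[t] f b x ≤ (G + B) / (1 - M.disc) := by
  have h1 : ∀ t, (M.stepMean pol)^[t] f b x ≤ (M.stepMean pol)^[t] g b x +
      M.disc * (M.stepMean pol)^[t + 1] f b x := fun t => by
    have h2 := M.iterate_stepMean_mono pol t h b x
    rwa [iterate_stepMean_add, iterate_stepMean_smul, ← Function.iterate_succ_apply] at h2
  have h3 := Finset.sum_le_sum fun t (_ : t ∈ Finset.range T) => h1 t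
  rw [Finset.sum_add_distrib, ← Finset.mul_sum] at h3
  have h4 : ∑ t ∈ Finset.range T, (M.stepMean pol)^[t + 1] f b x ≤
      ∑ t ∈ Finset.range T, (M.stepMean pol)^[t] f b x + B := by
    have h5 := Finset.sum_range_succ' (fun t => (M.stepMean pol)^[t] f b x) T
    rw [Finset.sum_range_succ] at h5
    have h6 := M.iterate_stepMean_le pol hB T b x
    have h7 : 0 ≤ (M.stepMean pol)^[0] f b x := hf b x
    linarith
  have hB0 : 0 ≤ B := (hf b x).trans (hB b x)
  have h8 := mul_le_mul_of_nonneg_left h4 M.disc_nonneg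
  have h9 := mul_le_of_le_one_left hB0 M.disc_lt_one.le
  rw [le_div_iff₀ (sub_pos.2 M.disc_lt_one)]
  linarith

/-! ### The value of a policy -/

theorem abs_expReward_le {R : ℝ} (hR : ∀ y a k, |M.reward y a k| ≤ R) (n : ℕ) (b : Belief Θ)
    (x : X) : |M.expReward pol n b x| ≤ R := by
  induction n generalizing b x with
  | zero => exact M.abs_meanReward_le hR _ _ _
  | succ n ih =>
    refine (abs_sum_mul_le fun x' => ih (M.update b x (pol b x) x') x').trans_eq ?_
    simp_rw [abs_of_nonneg (M.meanTrans_nonneg b x _ _), M.meanTrans_sum, mul_one]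

theorem abs_discounted_expReward_le {R : ℝ} (hR : ∀ y a k, |M.reward y a k| ≤ R) (n : ℕ)
    (b : Belief Θ) (x : X) : ‖M.disc ^ n * M.expReward pol n b x‖ ≤ M.disc ^ n * R := by
  rw [Real.norm_eq_abs, abs_mul, abs_of_nonneg (pow_nonneg M.disc_nonneg n)]
  exact mul_le_mul_of_nonneg_left (M.abs_expReward_le pol hR n b x) (pow_nonneg M.disc_nonneg n)

theorem summable_expReward {R : ℝ} (hR : ∀ y a k, |M.reward y a k| ≤ R)
    (b : Belief Θ) (x : X) : Summable fun n => M.disc ^ n * M.expReward pol n b x :=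
  Summable.of_norm_bounded
    ((summable_geometric_of_lt_one M.disc_nonneg M.disc_lt_one).mul_right R)
    fun n => M.abs_discounted_expReward_le pol hR n b x

theorem abs_policyValue_le {R : ℝ} (hR : ∀ y a k, |M.reward y a k| ≤ R)
    (b : Belief Θ) (x : X) : |M.policyValue pol b x| ≤ R / (1 - M.disc) := by
  have h := (hasSum_geometric_of_lt_one M.disc_nonneg M.disc_lt_one).mul_right R
  rw [inv_mul_eq_div] at h
  exact tsum_of_norm_bounded h fun n => M.abs_discounted_expReward_le pol hR n b x

theorem policyValue_eq {R : ℝ} (hR : ∀ y a k, |M.reward y a k| ≤ R) (b : Belief Θ) (x : X) :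
    M.policyValue pol b x =
      M.meanReward b x (pol b x) + M.disc * M.stepMean pol (M.policyValue pol) b x := by
  rw [policyValue, (M.summable_expReward pol hR b x).tsum_eq_zero_add, pow_zero, one_mul]
  congr 1
  simp only [stepMean, policyValue]
  simp_rw [← tsum_mul_left]
  rw [← Summable.tsum_finsetSum fun x' _ => (M.summable_expReward pol hR _ _).mul_left _,
    ← tsum_mul_left]
  refine tsum_congr fun n => ?_
  rw [expReward, Finset.mul_sum, Finset.mul_sum]
  exact Finset.sum_congr rfl fun _ _ => by ring

/-- The loss of the algorithm against its own optimistic plan comes from belief changes, and those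
are measured by the bonus. -/
theorem guidedValue_sub_policyValue_le [Nonempty AR] {R β : ℝ} {pG : X → AR → ℝ}
    {alg : Belief Θ → X → AR} (halg : M.IsGuidedPolicy β pG alg)
    (hR : ∀ y a k, |M.reward y a k| ≤ R) (hβ : ∀ y a, |β * pG y a| ≤ β)
    (b : Belief Θ) (x : X) :
    M.guidedValue β pG b x - M.policyValue alg b x ≤
      (β + (3 * β + R + (2 * β + R) / (1 - M.disc)) / (1 - M.disc)) * M.bonus b x (alg b x) +
      M.disc * M.stepMean alg (fun b y => M.guidedValue β pG b y - M.policyValue alg b y) b x := by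
  set a := alg b x with ha
  set L := (3 * β + R + (2 * β + R) / (1 - M.disc)) / (1 - M.disc) with hL
  have hβ0 : 0 ≤ β := (abs_nonneg _).trans (hβ x a)
  have hR0 := M.nonneg_of_abs_reward_le hR b x
  have hγ1 : 0 < 1 - M.disc := sub_pos.2 M.disc_lt_one
  have hL0 : 0 ≤ L := by positivity
  have h1 : M.guidedValue β pG b x ≤ M.guidedQ β pG b x a := by
    rw [M.guidedValue_eq]
    exact ciSup_le (halg b x)
  have h2 : M.stepMean alg (fun b y => M.guidedValue β pG b y - M.policyValue alg b y) b x =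
      ∑ x', M.meanTrans b x a x' * M.guidedValue β pG (M.update b x a x') x' -
        M.stepMean alg (M.policyValue alg) b x := by
    simp only [stepMean, mul_sub, Finset.sum_sub_distrib, ← ha]
  have h3 : ∑ x', M.meanTrans b x a x' * M.guidedValue β pG b x' ≤
      ∑ x', M.meanTrans b x a x' * M.guidedValue β pG (M.update b x a x') x' +
        L * M.bonus b x a := by
    rw [bonus, Finset.mul_sum, ← Finset.sum_add_distrib]
    refine Finset.sum_le_sum fun x' _ => ?_
    have h4 := (abs_le.1 (M.abs_guidedValue_sub_le hR hβ (M.update b x a x') b x')).1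
    have h5 := mul_le_mul_of_nonneg_left h4 (M.meanTrans_nonneg b x a x')
    rw [← hL] at h5
    linarith
  have hb := M.bonus_nonneg b x a
  have h6 : β * pG x a * M.bonus b x a ≤ β * M.bonus b x a :=
    mul_le_mul_of_nonneg_right ((le_abs_self _).trans (hβ x a)) hb
  have h7 := mul_le_mul_of_nonneg_left h3 M.disc_nonneg
  have h8 := mul_le_of_le_one_left (mul_nonneg hL0 hb) M.disc_lt_one.le
  rw [guidedQ] at h1
  simp_rw [mul_assoc M.disc, ← Finset.mul_sum] at h1
  rw [h2, M.policyValue_eq alg hR, ← ha]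
  linarith

/-! ### Posterior variance as a potential -/

/-- The mean of `q` under the belief `b`. -/
def mean (b : Belief Θ) (q : Θ → ℝ) : ℝ := ∑ θ, b.1 θ * q θ

/-- The variance of `q` under the belief `b`. -/
def var (b : Belief Θ) (q : Θ → ℝ) : ℝ := ∑ θ, b.1 θ * (q θ - mean b q) ^ 2

theorem var_eq (b : Belief Θ) (q : Θ → ℝ) :
    var b q = ∑ θ, b.1 θ * q θ ^ 2 - mean b q ^ 2 := by
  have e : var b q = ∑ θ, (b.1 θ * q θ ^ 2 - 2 * mean b q * (b.1 θ * q θ) +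
      mean b q ^ 2 * b.1 θ) := Finset.sum_congr rfl fun θ _ => by ring
  rw [e, Finset.sum_add_distrib, Finset.sum_sub_distrib, ← Finset.mul_sum, ← Finset.mul_sum,
    b.2.2]
  change _ - 2 * mean b q * mean b q + _ = _
  ring

theorem var_nonneg (b : Belief Θ) (q : Θ → ℝ) : 0 ≤ var b q :=
  Finset.sum_nonneg fun θ _ => mul_nonneg (b.2.1 θ) (sq_nonneg _)

theorem var_le_one (b : Belief Θ) {q : Θ → ℝ} (h0 : ∀ θ, 0 ≤ q θ) (h1 : ∀ θ, q θ ≤ 1) :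
    var b q ≤ 1 := by
  have h : ∑ θ, b.1 θ * q θ ^ 2 ≤ ∑ θ, b.1 θ := Finset.sum_le_sum fun θ _ =>
    mul_le_of_le_one_right (b.2.1 θ) (pow_le_one₀ (h0 θ) (h1 θ))
  rw [b.2.2] at h
  rw [var_eq]
  linarith [sq_nonneg (mean b q)]

theorem sum_abs_dev_sq_le (b : Belief Θ) (q : Θ → ℝ) :
    (∑ θ, b.1 θ * |q θ - mean b q|) ^ 2 ≤ var b q := by
  refine (Real.pow_arith_mean_le_arith_mean_pow_of_even Finset.univ b.1 _ (fun θ _ => b.2.1 θ)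
    b.2.2 even_two).trans_eq ?_
  simp_rw [sq_abs]
  rfl

/-- Beliefs form a martingale: the posterior mean has the prior mean as its expectation. -/
theorem sum_meanTrans_mul_mean_update (b : Belief Θ) (x : X) (a : AR) (q : Θ → ℝ) :
    ∑ x', M.meanTrans b x a x' * mean (M.update b x a x') q = mean b q := by
  simp_rw [mean, Finset.mul_sum, ← mul_assoc, M.meanTrans_mul_update]
  rw [Finset.sum_comm]
  simp_rw [mul_right_comm, ← Finset.mul_sum, M.lik_sum, mul_one]

/-- The law of total variance. -/
theorem sum_meanTrans_mul_var_update (b : Belief Θ) (x : X) (a : AR) (q : Θ → ℝ) :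
    ∑ x', M.meanTrans b x a x' * var (M.update b x a x') q =
      var b q - ∑ x', M.meanTrans b x a x' * (mean (M.update b x a x') q - mean b q) ^ 2 := by
  have h1 : ∑ x', M.meanTrans b x a x' * mean (M.update b x a x') (fun θ => q θ ^ 2) =
      mean b fun θ => q θ ^ 2 := M.sum_meanTrans_mul_mean_update b x a _
  have h2 := M.sum_meanTrans_mul_mean_update b x a q
  have e : ∀ x', M.meanTrans b x a x' * var (M.update b x a x') q =
      M.meanTrans b x a x' * mean (M.update b x a x') (fun θ => q θ ^ 2) -
      M.meanTrans b x a x' * (mean (M.update b x a x') q - mean b q) ^ 2 -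
      2 * mean b q * (M.meanTrans b x a x' * mean (M.update b x a x') q) +
      mean b q ^ 2 * M.meanTrans b x a x' := fun x' => by
    rw [var_eq, ← mean]
    ring
  simp_rw [e]
  rw [Finset.sum_add_distrib, Finset.sum_sub_distrib, Finset.sum_sub_distrib, ← Finset.mul_sum,
    ← Finset.mul_sum, h1, h2, M.meanTrans_sum, var_eq, ← mean]
  ring

theorem sum_meanTrans_mul_var_update_le (b : Belief Θ) (x : X) (a : AR) (q : Θ → ℝ) :
    ∑ x', M.meanTrans b x a x' * var (M.update b x a x') q ≤ var b q := by
  rw [M.sum_meanTrans_mul_var_update]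
  have : 0 ≤ ∑ x', M.meanTrans b x a x' * (mean (M.update b x a x') q - mean b q) ^ 2 :=
    Finset.sum_nonneg fun x' _ => mul_nonneg (M.meanTrans_nonneg b x a x') (sq_nonneg _)
  linarith

/-- Performing `a` in `x` decreases the variance `v` of the unknown probability of the arrival `y` by
at least `v ^ 2`, because that probability is correlated with the event that `y` is seen. -/
theorem sum_meanTrans_mul_var_update_lik_le (b : Belief Θ) (x : X) (a : AR) (y : X) :
    ∑ x', M.meanTrans b x a x' * var (M.update b x a x') (fun θ => M.lik θ x a y) ≤
      var b (fun θ => M.lik θ x a y) - var b (fun θ => M.lik θ x a y) ^ 2 := by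
  rw [M.sum_meanTrans_mul_var_update]
  refine sub_le_sub_left ?_ _
  set q : Θ → ℝ := fun θ => M.lik θ x a y with hq
  have hm : mean b q = M.meanTrans b x a y := rfl
  refine le_trans ?_ (Finset.single_le_sum (f := fun x' => M.meanTrans b x a x' *
    (mean (M.update b x a x') q - mean b q) ^ 2) (fun x' _ =>
      mul_nonneg (M.meanTrans_nonneg b x a x') (sq_nonneg _)) (Finset.mem_univ y))
  have hv : var b q = M.meanTrans b x a y * (mean (M.update b x a y) q - mean b q) := by
    rw [mul_sub, mean, Finset.mul_sum, var_eq, sq (mean b q), ← hm]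
    congr 1
    refine Finset.sum_congr rfl fun θ _ => ?_
    rw [← mul_assoc, hm, M.meanTrans_mul_update]
    ring
  rw [hv, mul_pow]
  refine mul_le_mul_of_nonneg_right ?_ (sq_nonneg _)
  rw [sq]
  exact mul_le_of_le_one_left (M.meanTrans_nonneg b x a y) (M.meanTrans_le_one b x a y)

/-- The potential of the argument: the total posterior variance of all transition probabilities. It
does not see the number of intentions. -/
def totalVar (b : Belief Θ) : ℝ := ∑ x, ∑ a, ∑ y, var b fun θ => M.lik θ x a y

theorem totalVar_nonneg (b : Belief Θ) : 0 ≤ M.totalVar b :=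
  Finset.sum_nonneg fun _ _ => Finset.sum_nonneg fun _ _ => Finset.sum_nonneg fun _ _ =>
    var_nonneg _ _

theorem totalVar_le (b : Belief Θ) :
    M.totalVar b ≤ (Fintype.card X : ℝ) ^ 2 * Fintype.card AR := by
  calc M.totalVar b ≤ ∑ _x : X, ∑ _a : AR, ∑ _y : X, (1 : ℝ) :=
        Finset.sum_le_sum fun x _ => Finset.sum_le_sum fun a _ => Finset.sum_le_sum fun y _ =>
          var_le_one b (fun θ => M.lik_nonneg θ x a y) (fun θ => M.lik_le_one θ x a y)
    _ = _ := by
        simp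
        ring

theorem sum_meanTrans_mul_totalVar_le (b : Belief Θ) (x : X) (a : AR) :
    ∑ x', M.meanTrans b x a x' * M.totalVar (M.update b x a x') ≤
      M.totalVar b - ∑ y, var b (fun θ => M.lik θ x a y) ^ 2 := by
  classical
  set d : X × AR → ℝ := fun z => if z = (x, a) then
    ∑ y, var b (fun θ => M.lik θ x a y) ^ 2 else 0 with hd
  have key : ∀ z : X × AR, ∑ x', M.meanTrans b x a x' *
      ∑ y, var (M.update b x a x') (fun θ => M.lik θ z.1 z.2 y) ≤
      ∑ y, var b (fun θ => M.lik θ z.1 z.2 y) - d z := by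
    intro z
    simp_rw [Finset.mul_sum]
    rw [Finset.sum_comm]
    by_cases hz : z = (x, a)
    · subst hz
      simp only [hd, if_true]
      rw [← Finset.sum_sub_distrib]
      exact Finset.sum_le_sum fun y _ => M.sum_meanTrans_mul_var_update_lik_le b x a y
    · simp only [hd, if_neg hz, sub_zero]
      exact Finset.sum_le_sum fun y _ => M.sum_meanTrans_mul_var_update_le b x a _
  have h := Finset.sum_le_sum fun z (_ : z ∈ Finset.univ) => key z
  rw [Finset.sum_sub_distrib, Finset.sum_comm] at h
  simp_rw [← Finset.mul_sum] at h
  simpa only [hd, Finset.sum_ite_eq', Finset.mem_univ, if_true, totalVar,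
    Fintype.sum_prod_type] using h

theorem bonus_pow_four_le (b : Belief Θ) (x : X) (a : AR) : M.bonus b x a ^ 4 ≤
    (Fintype.card X : ℝ) ^ 3 * ∑ y, var b (fun θ => M.lik θ x a y) ^ 2 := by
  set n : ℝ := (Fintype.card X : ℝ) with hn
  have h1 : M.bonus b x a ^ 2 ≤ n * ∑ y, var b (fun θ => M.lik θ x a y) := by
    rw [M.bonus_eq]
    refine (sq_sum_le_card_mul_sum_sq (s := Finset.univ)).trans ?_
    rw [Finset.card_univ]
    exact mul_le_mul_of_nonneg_left
      (Finset.sum_le_sum fun y _ => sum_abs_dev_sq_le b fun θ => M.lik θ x a y) (by positivity)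
  have h2 : (∑ y, var b (fun θ => M.lik θ x a y)) ^ 2 ≤
      n * ∑ y, var b (fun θ => M.lik θ x a y) ^ 2 := by
    refine (sq_sum_le_card_mul_sum_sq (s := Finset.univ)).trans_eq ?_
    rw [Finset.card_univ]
  calc M.bonus b x a ^ 4 = (M.bonus b x a ^ 2) ^ 2 := by ring
    _ ≤ (n * ∑ y, var b (fun θ => M.lik θ x a y)) ^ 2 := pow_le_pow_left₀ (sq_nonneg _) h1 2
    _ = n ^ 2 * (∑ y, var b (fun θ => M.lik θ x a y)) ^ 2 := by ring
    _ ≤ n ^ 2 * (n * ∑ y, var b (fun θ => M.lik θ x a y) ^ 2) :=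
        mul_le_mul_of_nonneg_left h2 (sq_nonneg _)
    _ = _ := by ring

/-- Under any policy the expected sum of the fourth powers of the bonuses is bounded, however many
intentions there are. -/
theorem sum_iterate_stepMean_bonus_pow_le (T : ℕ) (b : Belief Θ) (x : X) :
    ∑ t ∈ Finset.range T, (M.stepMean pol)^[t] (fun b x => M.bonus b x (pol b x) ^ 4) b x ≤
      (Fintype.card X : ℝ) ^ 5 * Fintype.card AR := by
  have hn : (0 : ℝ) ≤ (Fintype.card X : ℝ) ^ 3 := by positivity
  refine (M.sum_iterate_stepMean_le pol
    (f := (Fintype.card X : ℝ) ^ 3 • fun b _ => M.totalVar b)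
    (fun b x => mul_nonneg hn (M.totalVar_nonneg b)) (fun b x => ?_) T b x).trans ?_
  · rw [stepMean_smul]
    simp only [Pi.add_apply, Pi.smul_apply, smul_eq_mul]
    have h1 := mul_le_mul_of_nonneg_left
      (M.sum_meanTrans_mul_totalVar_le b x (pol b x)) hn
    have h2 := M.bonus_pow_four_le b x (pol b x)
    rw [stepMean]
    linarith
  · refine (mul_le_mul_of_nonneg_left (M.totalVar_le b) hn).trans_eq ?_
    ring

/-! ### The expected number of steps with a large loss -/

/-- The beliefs and states from which the guided policy loses more than `4 ε` against its optimistic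
value function. -/
def largeLoss [Nonempty AR] (β : ℝ) (pG : X → AR → ℝ) (alg : Belief Θ → X → AR) (ε : ℝ) :
    Set (Belief Θ × X) :=
  {s | 4 * ε < M.guidedValue β pG s.1 s.2 - M.policyValue alg s.1 s.2}

theorem sum_iterate_stepMean_largeLoss_le [Nonempty AR] {R β K ε : ℝ} {pG : X → AR → ℝ}
    {alg : Belief Θ → X → AR} (halg : M.IsGuidedPolicy β pG alg)
    (hR : ∀ y a k, |M.reward y a k| ≤ R) (hβ : ∀ y a, |β * pG y a| ≤ β) (hε : 0 < ε)
    (hK0 : 0 < K)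
    (hK1 : β + (3 * β + R + (2 * β + R) / (1 - M.disc)) / (1 - M.disc) ≤ K)
    (hK2 : (2 * β + R) / (1 - M.disc) + R / (1 - M.disc) ≤ K)
    (b : Belief Θ) (x : X) (T : ℕ) :
    ∑ t ∈ Finset.range T, (M.stepMean alg)^[t]
      (fun b x => (M.largeLoss β pG alg ε).indicator 1 (b, x)) b x ≤
      1 / ε * (1 / (1 - M.disc)) * (K ^ 4 * (1 / (1 - M.disc)) ^ 3 * (1 / ε) ^ 3 *
        ((Fintype.card X : ℝ) ^ 5 * Fintype.card AR) + K) := by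
  have hγ1 : 0 < 1 - M.disc := sub_pos.2 M.disc_lt_one
  set c := K ^ 4 * (1 / (1 - M.disc)) ^ 3 * (1 / ε) ^ 3 with hc
  have hc0 : 0 ≤ c := by positivity
  set G : Belief Θ → X → ℝ := fun b y => M.guidedValue β pG b y - M.policyValue alg b y with hG
  set H : Belief Θ → X → ℝ := fun b y => max (G b y - ε) 0 with hH
  set g : Belief Θ → X → ℝ := fun b y => M.bonus b y (alg b y) ^ 4 with hg
  have hH0 : ∀ b y, 0 ≤ H b y := fun b y => le_max_right _ _
  have hHB : ∀ b y, H b y ≤ K := fun b y => by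
    have h1 := (abs_le.1 (M.abs_guidedValue_le hR hβ b y)).2
    have h2 := (abs_le.1 (M.abs_policyValue_le alg hR b y)).1
    exact max_le (by simp only [hG]; linarith) hK0.le
  -- The bonus is split at `η = ε (1 - γ) / K`: bonuses below `η` cost at most `ε` in total, and a
  -- larger bonus is at most its fourth power over `η ^ 3`.
  have hsplit : ∀ b y, K * M.bonus b y (alg b y) ≤ ε * (1 - M.disc) + c * g b y := by
    intro b y
    set r := M.bonus b y (alg b y) with hr
    have hr0 : 0 ≤ r := M.bonus_nonneg b y _
    have hg4 : g b y = r ^ 4 := rfl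
    rcases le_total (K * r) (ε * (1 - M.disc)) with h | h
    · have : 0 ≤ c * g b y := mul_nonneg hc0 (by rw [hg4]; positivity)
      linarith
    · have h1 : 1 ≤ K * r / (ε * (1 - M.disc)) := (one_le_div (by positivity)).2 h
      have h2 : c * g b y = K * r * (K * r / (ε * (1 - M.disc))) ^ 3 := by
        rw [hc, hg4]
        field_simp
      have h3 := le_mul_of_one_le_right (mul_nonneg hK0.le hr0) (one_le_pow₀ (n := 3) h1)
      have h4 : 0 ≤ ε * (1 - M.disc) := by positivity
      linarith
  have hrec : H ≤ c • g + M.disc • M.stepMean alg H := by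
    intro b y
    simp only [Pi.add_apply, Pi.smul_apply, smul_eq_mul]
    have hKH : 0 ≤ M.stepMean alg H b y := M.iterate_stepMean_nonneg alg hH0 1 b y
    refine max_le ?_ (add_nonneg (mul_nonneg hc0 (by simp only [hg]; positivity))
      (mul_nonneg M.disc_nonneg hKH))
    have h1 : G b y ≤ _ := M.guidedValue_sub_policyValue_le halg hR hβ b y
    have h2 := mul_le_mul_of_nonneg_right hK1 (M.bonus_nonneg b y (alg b y))
    have h3 := hsplit b y
    have h4 : M.stepMean alg G b y ≤ M.stepMean alg H b y + ε := by
      have h5 := M.stepMean_mono alg (f := G) (g := H + fun _ _ => ε) (fun b y => by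
        have h6 : G b y - ε ≤ H b y := le_max_left _ _
        simp only [Pi.add_apply]
        linarith) b y
      rwa [stepMean_add, stepMean_const] at h5
    have h5 := mul_le_mul_of_nonneg_left h4 M.disc_nonneg
    linarith
  have hsum := M.sum_iterate_stepMean_le_of_discounted alg hHB hH0 hrec b x T
    (G := c * ((Fintype.card X : ℝ) ^ 5 * Fintype.card AR)) (by
      simp_rw [iterate_stepMean_smul]
      simp only [Pi.smul_apply, smul_eq_mul]
      rw [← Finset.mul_sum]
      exact mul_le_mul_of_nonneg_left (M.sum_iterate_stepMean_bonus_pow_le alg T b x) hc0)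
  have hind : (fun b x => (M.largeLoss β pG alg ε).indicator 1 (b, x)) ≤ (1 / ε) • H := by
    intro b y
    simp only [Pi.smul_apply, smul_eq_mul]
    by_cases hs : (b, y) ∈ M.largeLoss β pG alg ε
    swap
    · rw [Set.indicator_of_notMem hs]
      exact mul_nonneg (by positivity) (hH0 b y)
    rw [Set.indicator_of_mem hs]
    have h1 : 4 * ε < G b y := hs
    have h2 : G b y - ε ≤ H b y := le_max_left _ _
    rw [Pi.one_apply, one_div_mul_eq_div, one_le_div hε]
    linarith
  calc _ ≤ ∑ t ∈ Finset.range T, (M.stepMean alg)^[t] ((1 / ε) • H) b x :=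
        Finset.sum_le_sum fun t _ => M.iterate_stepMean_mono alg t hind b x
    _ = 1 / ε * ∑ t ∈ Finset.range T, (M.stepMean alg)^[t] H b x := by
        simp_rw [iterate_stepMean_smul]
        simp only [Pi.smul_apply, smul_eq_mul]
        rw [← Finset.mul_sum]
    _ ≤ 1 / ε * _ := mul_le_mul_of_nonneg_left hsum (by positivity)
    _ = _ := by ring

/-! ### The law of a run -/

theorem beliefAt_congr (b₀ : Belief Θ) {ξ ξ' : ℕ → X} {n : ℕ} (h : ∀ i ≤ n, ξ i = ξ' i) :
    M.beliefAt pol b₀ ξ n = M.beliefAt pol b₀ ξ' n := by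
  induction n with
  | zero => rfl
  | succ n ih =>
    rw [beliefAt, beliefAt, ih fun i hi => h i (by omega), h n (by omega), h (n + 1) le_rfl]

/-- The probability that the state process follows `ξ` for `n` steps, as a product of mean
transition probabilities. -/
def pathProb (b₀ : Belief Θ) (ξ : ℕ → X) (n : ℕ) : ℝ :=
  ∏ i ∈ Finset.range n, M.meanTrans (M.beliefAt pol b₀ ξ i) (ξ i)
    (pol (M.beliefAt pol b₀ ξ i) (ξ i)) (ξ (i + 1))

theorem pathProb_nonneg (b₀ : Belief Θ) (ξ : ℕ → X) (n : ℕ) : 0 ≤ M.pathProb pol b₀ ξ n :=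
  Finset.prod_nonneg fun _ _ => M.meanTrans_nonneg _ _ _ _

/-- The belief after `n` steps is the posterior of the intention given the path. -/
theorem beliefAt_mul_pathProb (b₀ : Belief Θ) (ξ : ℕ → X) (n : ℕ) (θ : Θ) :
    b₀.1 θ * ∏ i ∈ Finset.range n, M.lik θ (ξ i) (pol (M.beliefAt pol b₀ ξ i) (ξ i)) (ξ (i + 1)) =
      (M.beliefAt pol b₀ ξ n).1 θ * M.pathProb pol b₀ ξ n := by
  induction n with
  | zero => simp [pathProb, beliefAt]
  | succ n ih =>
    have h1 : M.pathProb pol b₀ ξ (n + 1) = M.pathProb pol b₀ ξ n * _ :=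
      Finset.prod_range_succ _ _
    rw [Finset.prod_range_succ, ← mul_assoc, ih, h1, beliefAt, mul_left_comm,
      mul_comm (M.update _ _ _ _ |>.1 θ), M.meanTrans_mul_update]
    ring

theorem nonempty_human (M : Model X AR AH Θ) (b : Belief Θ) (x : X) : Nonempty AH := by
  by_contra hAH
  rw [not_nonempty_iff] at hAH
  have hΘ : Nonempty Θ := by
    by_contra hΘ
    rw [not_nonempty_iff] at hΘ
    have := b.2.2
    simp at this
  have := M.human_sum x hΘ.some
  simp at this

variable {Ω : Type*} [MeasurableSpace Ω] {P : Measure Ω} {θ : Ω → Θ} {x : ℕ → Ω → X}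
  {h : ℕ → Ω → AH} {b₀ : Belief Θ} {x₀ : X}

variable {M pol}

/-- The law of the states of a run: intention and human actions are averaged out. The upper bound is
all that is needed, and it follows from subadditivity. -/
theorem IsRun.measure_path_le (hrun : M.IsRun pol b₀ x₀ P θ x h) (n : ℕ) {ξ : ℕ → X}
    (hξ : ξ 0 = x₀) :
    P {ω | ∀ i ≤ n, x i ω = ξ i} ≤ ENNReal.ofReal (M.pathProb pol b₀ ξ n) := by
  classical
  have := M.nonempty_human b₀ x₀
  let ext : (Fin n → AH) → ℕ → AH := fun η i =>
    if hi : i < n then η ⟨i, hi⟩ else Classical.arbitrary AH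
  have hsub : {ω | ∀ i ≤ n, x i ω = ξ i} ⊆ ⋃ z : Θ × (Fin n → AH),
      {ω | θ ω = z.1 ∧ (∀ i ≤ n, x i ω = ξ i) ∧ ∀ i < n, h i ω = ext z.2 i} := by
    intro ω hω
    refine Set.mem_iUnion.2 ⟨(θ ω, fun i => h i ω), rfl, hω, fun i hi => ?_⟩
    simp [ext, hi]
  refine (measure_mono hsub).trans ((measure_iUnion_fintype_le P _).trans_eq ?_)
  simp_rw [fun z : Θ × (Fin n → AH) => hrun.law n z.1 ξ (ext z.2) hξ]
  rw [← ENNReal.ofReal_sum_of_nonneg fun z _ => mul_nonneg (b₀.2.1 _)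
    (Finset.prod_nonneg fun i _ => mul_nonneg (M.human_nonneg _ _ _) (M.trans_nonneg _ _ _ _))]
  congr 1
  rw [Fintype.sum_prod_type]
  have e : ∀ ϑ, ∑ η : Fin n → AH, b₀.1 ϑ * ∏ i ∈ Finset.range n,
      (M.human (ξ i) ϑ (ext η i) * M.trans (ξ i) (pol (M.beliefAt pol b₀ ξ i) (ξ i))
        (ext η i) (ξ (i + 1))) = (M.beliefAt pol b₀ ξ n).1 ϑ * M.pathProb pol b₀ ξ n := by
    intro ϑ
    rw [← M.beliefAt_mul_pathProb, ← Finset.mul_sum, Finset.prod_range]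
    simp_rw [lik]
    rw [Finset.prod_univ_sum, Fintype.piFinset_univ]
    congr 1
    refine Finset.sum_congr rfl fun η _ => ?_
    rw [Finset.prod_range]
    refine Finset.prod_congr rfl fun i _ => ?_
    simp [ext]
  simp_rw [e]
  rw [← Finset.sum_mul, (M.beliefAt pol b₀ ξ n).2.2, one_mul]

/-- Beliefs and states of a run form a Markov process with transition operator `stepMean`, here after
an initial piece `ξ` of the path. -/
theorem IsRun.measure_path_inter_le (hrun : M.IsRun pol b₀ x₀ P θ x h) (A : Set (Belief Θ × X))
    (t : ℕ) : ∀ (k : ℕ) (ξ : ℕ → X), ξ 0 = x₀ →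
      P {ω | (∀ i ≤ k, x i ω = ξ i) ∧
        (M.beliefAt pol b₀ (fun s => x s ω) (k + t), x (k + t) ω) ∈ A} ≤
      ENNReal.ofReal (M.pathProb pol b₀ ξ k *
        (M.stepMean pol)^[t] (fun b x => A.indicator 1 (b, x)) (M.beliefAt pol b₀ ξ k) (ξ k)) := by
  classical
  induction t with
  | zero =>
    intro k ξ hξ
    rw [add_zero, Function.iterate_zero, id]
    by_cases hA : (M.beliefAt pol b₀ ξ k, ξ k) ∈ A
    · rw [Set.indicator_of_mem hA, Pi.one_apply, mul_one]
      exact (measure_mono fun ω hω => hω.1).trans (hrun.measure_path_le k hξ)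
    · refine le_of_eq_of_le ?_ zero_le
      convert measure_empty (μ := P)
      refine Set.eq_empty_of_forall_notMem fun ω hω => hA ?_
      have h1 := hω.2
      rwa [M.beliefAt_congr pol b₀ hω.1, hω.1 k le_rfl] at h1
  | succ t ih =>
    intro k ξ hξ
    have hsub : {ω | (∀ i ≤ k, x i ω = ξ i) ∧
        (M.beliefAt pol b₀ (fun s => x s ω) (k + (t + 1)), x (k + (t + 1)) ω) ∈ A} ⊆
        ⋃ y, {ω | (∀ i ≤ k + 1, x i ω = Function.update ξ (k + 1) y i) ∧
          (M.beliefAt pol b₀ (fun s => x s ω) (k + 1 + t), x (k + 1 + t) ω) ∈ A} := by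
      rintro ω ⟨h1, h2⟩
      refine Set.mem_iUnion.2 ⟨x (k + 1) ω, fun i hi => ?_, ?_⟩
      · rcases eq_or_ne i (k + 1) with rfl | hne
        · simp
        · rw [Function.update_of_ne hne]
          exact h1 i (by omega)
      · rwa [show k + 1 + t = k + (t + 1) by omega]
    have hcongr : ∀ y, ∀ i ≤ k, Function.update ξ (k + 1) y i = ξ i := fun y i hi =>
      Function.update_of_ne (by omega) _ _
    have hnn : ∀ b y, 0 ≤ (M.stepMean pol)^[t] (fun b x => A.indicator 1 (b, x)) b y :=
      M.iterate_stepMean_nonneg pol (fun b x => Set.indicator_nonneg (fun _ _ => zero_le_one) _) t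
    refine (measure_mono hsub).trans ((measure_iUnion_fintype_le P _).trans
      ((Finset.sum_le_sum fun y _ => ih (k + 1) (Function.update ξ (k + 1) y)
        (by rw [hcongr y 0 (by omega), hξ])).trans_eq ?_))
    rw [← ENNReal.ofReal_sum_of_nonneg fun y _ => mul_nonneg (M.pathProb_nonneg _ _ _ _) (hnn _ _),
      Function.iterate_succ_apply']
    congr 1
    rw [stepMean, Finset.mul_sum]
    refine Finset.sum_congr rfl fun y _ => ?_
    have h1 : M.pathProb pol b₀ (Function.update ξ (k + 1) y) k = M.pathProb pol b₀ ξ k := by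
      refine Finset.prod_congr rfl fun i hi => ?_
      have hi := Finset.mem_range.1 hi
      rw [M.beliefAt_congr pol b₀ fun j (hj : j ≤ i) => hcongr y j (by omega),
        hcongr y i (by omega), hcongr y (i + 1) (by omega)]
    rw [pathProb, Finset.prod_range_succ, ← pathProb, h1, beliefAt,
      M.beliefAt_congr pol b₀ (hcongr y), hcongr y k le_rfl, Function.update_self, mul_assoc]

theorem IsRun.measure_start (hrun : M.IsRun pol b₀ x₀ P θ x h) : P {ω | x 0 ω = x₀} = 1 := by
  have e : {ω | x 0 ω = x₀} = ⋃ ϑ, {ω | θ ω = ϑ ∧ x 0 ω = x₀} := by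
    ext ω
    simp
  have := M.nonempty_human b₀ x₀
  have h0 : ∀ ϑ, P {ω | θ ω = ϑ ∧ x 0 ω = x₀} = ENNReal.ofReal (b₀.1 ϑ) := fun ϑ => by
    simpa using hrun.law 0 ϑ (fun _ => x₀) (fun _ => Classical.arbitrary AH) rfl
  rw [e, measure_iUnion, tsum_fintype]
  · simp_rw [h0]
    rw [← ENNReal.ofReal_sum_of_nonneg fun ϑ _ => b₀.2.1 ϑ, b₀.2.2, ENNReal.ofReal_one]
  · intro ϑ ϑ' hne
    exact Set.disjoint_left.2 fun ω h1 h2 => hne (h1.1.symm.trans h2.1)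
  · exact fun ϑ => (hrun.measurable_intention ϑ).inter (hrun.measurable_state 0 x₀)

theorem IsRun.measure_mem_le [IsProbabilityMeasure P] (hrun : M.IsRun pol b₀ x₀ P θ x h)
    (A : Set (Belief Θ × X)) (t : ℕ) :
    P {ω | (M.beliefAt pol b₀ (fun s => x s ω) t, x t ω) ∈ A} ≤
      ENNReal.ofReal ((M.stepMean pol)^[t] (fun b x => A.indicator 1 (b, x)) b₀ x₀) := by
  have hae : ∀ᵐ ω ∂P, x 0 ω = x₀ :=
    (mem_ae_iff_prob_eq_one (hrun.measurable_state 0 x₀)).2 hrun.measure_start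
  have h1 := hrun.measure_path_inter_le A t 0 (fun _ => x₀) rfl
  simp only [zero_add, pathProb, Finset.range_zero, Finset.prod_empty, one_mul, beliefAt] at h1
  refine (measure_mono_ae ?_).trans h1
  filter_upwards [hae] with ω h0 hω
  exact ⟨fun i hi => by rw [Nat.le_zero.1 hi, h0], hω⟩

theorem IsRun.measurableSet_mem (hrun : M.IsRun pol b₀ x₀ P θ x h)
    (A : Set (Belief Θ × X)) (t : ℕ) :
    MeasurableSet {ω | (M.beliefAt pol b₀ (fun s => x s ω) t, x t ω) ∈ A} := by
  -- The event is a finite union of cylinders.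
  let ext : (Fin (t + 1) → X) → ℕ → X := fun w i => if hi : i < t + 1 then w ⟨i, hi⟩ else x₀
  have e : {ω | (M.beliefAt pol b₀ (fun s => x s ω) t, x t ω) ∈ A} =
      ⋃ w ∈ {w : Fin (t + 1) → X | (M.beliefAt pol b₀ (ext w) t, ext w t) ∈ A},
        ⋂ i : Fin (t + 1), {ω | x i ω = w i} := by
    have hext : ∀ (ω : Ω) (w : Fin (t + 1) → X), (∀ i : Fin (t + 1), x i ω = w i) →
        ∀ i ≤ t, x i ω = ext w i := fun ω w hw i hi => by
      simp only [ext, dif_pos (Nat.lt_succ_of_le hi)]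
      exact hw ⟨i, Nat.lt_succ_of_le hi⟩
    ext ω
    simp only [Set.mem_ofPred_eq, Set.mem_iUnion, Set.mem_iInter, exists_prop]
    constructor
    · intro hω
      refine ⟨fun i => x i ω, ?_, fun i => rfl⟩
      have h1 := hext ω (fun i => x i ω) fun i => rfl
      rwa [← M.beliefAt_congr pol b₀ h1, ← h1 t le_rfl]
    · rintro ⟨w, hA, hw⟩
      have h1 := hext ω w hw
      rwa [M.beliefAt_congr pol b₀ h1, h1 t le_rfl]
  rw [e]
  exact (Set.toFinite _).measurableSet_biUnion fun w _ =>
    MeasurableSet.iInter fun i => hrun.measurable_state i (w i)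

end Model

/-- Markov's inequality for the number of events of a sequence that occur. -/
theorem ofReal_one_sub_le_measure_card_le {Ω : Type*} [MeasurableSpace Ω] {P : Measure Ω}
    [IsProbabilityMeasure P] {E : ℕ → Set Ω} (hE : ∀ t, MeasurableSet (E t)) {p : ℕ → ℝ}
    (hp : ∀ t, 0 ≤ p t) (hEp : ∀ t, P (E t) ≤ ENNReal.ofReal (p t)) {m δ : ℝ} (hm : 0 < m)
    (hsum : ∀ T, ∑ t ∈ Finset.range T, p t ≤ δ * m) :
    ENNReal.ofReal (1 - δ) ≤
      P {ω | ∃ bad : Finset ℕ, (bad.card : ℝ) ≤ m ∧ ∀ t ∉ bad, ω ∉ E t} := by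
  set N : Ω → ENNReal := fun ω => ∑' t, (E t).indicator 1 ω with hN
  have hNm : Measurable N := Measurable.tsum fun t => measurable_one.indicator (hE t)
  have hδ : 0 ≤ δ := by
    have := hsum 0
    simp only [Finset.range_zero, Finset.sum_empty] at this
    exact nonneg_of_mul_nonneg_left this hm
  have hint : ∫⁻ ω, N ω ∂P ≤ ENNReal.ofReal (δ * m) := by
    rw [lintegral_tsum fun t => (measurable_one.indicator (hE t)).aemeasurable]
    simp_rw [lintegral_indicator_one (hE _)]
    refine ENNReal.tsum_le_of_sum_range_le fun T => ?_
    refine (Finset.sum_le_sum fun t _ => hEp t).trans ?_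
    rw [← ENNReal.ofReal_sum_of_nonneg fun t _ => hp t]
    exact ENNReal.ofReal_le_ofReal (hsum T)
  set S := {ω | ENNReal.ofReal m ≤ N ω} with hS
  have hSm : MeasurableSet S := measurableSet_le measurable_const hNm
  have hPS : P S ≤ ENNReal.ofReal δ := by
    have h1 := (mul_meas_ge_le_lintegral hNm (ENNReal.ofReal m)).trans hint
    rw [mul_comm δ m, ENNReal.ofReal_mul hm.le] at h1
    exact (ENNReal.mul_le_mul_iff_right (ENNReal.ofReal_pos.2 hm).ne' ENNReal.ofReal_ne_top).1 h1
  have hsub : Sᶜ ⊆ {ω | ∃ bad : Finset ℕ, (bad.card : ℝ) ≤ m ∧ ∀ t ∉ bad, ω ∉ E t} := by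
    intro ω hω
    have hω : N ω < ENNReal.ofReal m := not_le.1 hω
    have hcard : ∀ F : Finset ℕ, (∀ t ∈ F, ω ∈ E t) → (F.card : ℝ) ≤ m := fun F hF => by
      have h1 : (F.card : ENNReal) ≤ N ω := by
        refine le_trans ?_ (ENNReal.sum_le_tsum F)
        rw [Finset.sum_congr rfl fun t ht => Set.indicator_of_mem (hF t ht) _]
        simp
      have h2 := h1.trans hω.le
      rw [← ENNReal.ofReal_natCast] at h2
      exact (ENNReal.ofReal_le_ofReal_iff hm.le).1 h2
    have hfin : {t | ω ∈ E t}.Finite := by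
      by_contra hinf
      obtain ⟨n, hn⟩ := exists_nat_gt m
      obtain ⟨F, hF, hFn⟩ := Set.Infinite.exists_subset_card_eq hinf n
      have := hcard F fun t ht => hF ht
      rw [hFn] at this
      linarith
    refine ⟨hfin.toFinset, hcard _ fun t ht => hfin.mem_toFinset.1 ht, fun t ht ht' => ht ?_⟩
    exact hfin.mem_toFinset.2 ht'
  refine le_trans ?_ (measure_mono hsub)
  rw [prob_compl_eq_one_sub hSm, ENNReal.ofReal_sub _ hδ, ENNReal.ofReal_one]
  exact tsub_le_tsub_left hPS 1

end
end GuidedExploration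

/-! ### The sample complexity bound -/

theorem theorem1 (R C : ℝ) :
    ∃ m : MvPolynomial (Fin 6) ℝ,
      ∀ (X AR AH Θ : Type*) [Fintype X] [Fintype AR] [Nonempty AR] [Fintype AH] [Fintype Θ]
        (M : GuidedExploration.Model X AR AH Θ) (pG : X → AR → ℝ) (φ β : ℝ)
        (alg : GuidedExploration.Belief Θ → X → AR)
        (b₀ : GuidedExploration.Belief Θ) (x₀ : X)
        (Ω : Type*) [MeasurableSpace Ω] (P : MeasureTheory.Measure Ω)
        [MeasureTheory.IsProbabilityMeasure P]
        (θ : Ω → Θ) (x : ℕ → Ω → X) (h : ℕ → Ω → AH) (δ ε : ℝ),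
        (∀ y a k, |M.reward y a k| ≤ R) →
        (∀ y a, pG y a ≤ 1) →
        IsLeast (Set.range fun z : X × AR => pG z.1 z.2) φ →
        0 < φ →
        R * M.bonusScale φ ≤ β →
        β ≤ C * M.bonusScale φ →
        M.IsGuidedPolicy β pG alg →
        M.IsRun alg b₀ x₀ P θ x h →
        0 < δ →
        0 < ε →
        ENNReal.ofReal (1 - δ) ≤ P {ω | ∃ bad : Finset ℕ,
          (bad.card : ℝ) ≤ MvPolynomial.eval ![(Fintype.card X : ℝ), (Fintype.card AR : ℝ),
            1 / ε, 1 / δ, 1 / (1 - M.disc), 1 / φ] m ∧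
          ∀ t ∉ bad, M.policyValue alg (M.beliefAt alg b₀ (fun s => x s ω) t) (x t ω) ≥
            M.bayesValue (M.beliefAt alg b₀ (fun s => x s ω) t) (x t ω) - 4 * ε} := by
  open MvPolynomial in
  -- The variables are `|X|`, `|A^R|`, `1 / ε`, `1 / δ`, `1 / (1 - γ)` and `1 / φ`. The value of `K`
  -- is at least `(6 β + 2 R) / (1 - γ) ^ 2`, which bounds both the coefficient of the bonus in the
  -- recursion for the loss and the loss itself.
  let K : MvPolynomial (Fin 6) ℝ :=
    (MvPolynomial.C (6 * |C|) * X 0 ^ 2 * X 1 * X 5 * X 4 ^ 2 + MvPolynomial.C (2 * R)) * X 4 ^ 2 + 1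
  open MvPolynomial in
  refine ⟨X 3 * (X 2 * X 4 * (K ^ 4 * X 4 ^ 3 * X 2 ^ 3 * (X 0 ^ 5 * X 1) + K)), ?_⟩
  intro X AR AH Θ _ _ _ _ _ M pG φ β alg b₀ x₀ Ω _ P _ θ x h δ ε hR hpG hφ hφ0 hβ1 hβ2 halg hrun
    hδ hε
  have hγ1 : 0 < 1 - M.disc := sub_pos.2 M.disc_lt_one
  have hR0 : 0 ≤ R := M.nonneg_of_abs_reward_le hR b₀ x₀
  have hX : Nonempty X := ⟨x₀⟩
  set n : ℝ := (Fintype.card X : ℝ) with hn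
  set k : ℝ := (Fintype.card AR : ℝ) with hk
  set u : ℝ := 1 / (1 - M.disc) with hu
  have hn1 : 1 ≤ n := Nat.one_le_cast.2 (Fintype.card_pos (α := X))
  have hk1 : 1 ≤ k := Nat.one_le_cast.2 (Fintype.card_pos (α := AR))
  have hu1 : 1 ≤ u := by
    rw [hu, one_le_div hγ1]
    linarith [M.disc_nonneg]
  have hscale : M.bonusScale φ = n ^ 2 * k * (1 / φ) * u ^ 2 := by
    rw [hu, GuidedExploration.Model.bonusScale, ← hn, ← hk]
    field_simp
  have hscale0 : 0 ≤ M.bonusScale φ := by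
    rw [hscale]
    positivity
  have hβ0 : 0 ≤ β := (mul_nonneg hR0 hscale0).trans hβ1
  have hpGφ : ∀ y a, φ ≤ pG y a := fun y a => hφ.2 ⟨(y, a), rfl⟩
  have hβpG : ∀ y a, |β * pG y a| ≤ β := fun y a => by
    rw [abs_of_nonneg (mul_nonneg hβ0 (hφ0.le.trans (hpGφ y a)))]
    exact mul_le_of_le_one_right hβ0 (hpG y a)
  have hopt : ∀ y a, R / (1 - M.disc) ≤ β * pG y a := fun y a => by
    calc R / (1 - M.disc) = R * u := by rw [hu, mul_one_div]
      _ ≤ R * (n ^ 2 * k * u ^ 2) := by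
        refine mul_le_mul_of_nonneg_left ?_ hR0
        have h1 : 1 ≤ n ^ 2 * k := one_le_mul_of_one_le_of_one_le (one_le_pow₀ hn1) hk1
        have h2 : u ≤ u ^ 2 := le_self_pow₀ hu1 two_ne_zero
        exact h2.trans (le_mul_of_one_le_left (sq_nonneg u) h1)
      _ = R * M.bonusScale φ * φ := by
        rw [hscale]
        field_simp
      _ ≤ β * φ := mul_le_mul_of_nonneg_right hβ1 hφ0.le
      _ ≤ β * pG y a := mul_le_mul_of_nonneg_left (hpGφ y a) hβ0
  set κ : ℝ := (6 * |C| * n ^ 2 * k * (1 / φ) * u ^ 2 + 2 * R) * u ^ 2 + 1 with hκ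
  have hκ0 : 0 < κ := by positivity
  have hβκ : (6 * β + 2 * R) * u ^ 2 ≤ κ := by
    have h1 : β ≤ |C| * (n ^ 2 * k * (1 / φ) * u ^ 2) := by
      rw [← hscale]
      exact hβ2.trans (mul_le_mul_of_nonneg_right (le_abs_self C) hscale0)
    have h2 := mul_le_mul_of_nonneg_right (show 6 * β + 2 * R ≤
      6 * |C| * n ^ 2 * k * (1 / φ) * u ^ 2 + 2 * R by linarith) (sq_nonneg u)
    linarith
  have hu2 : u ≤ u ^ 2 := le_self_pow₀ hu1 two_ne_zero
  have hu3 : 1 ≤ u ^ 2 := one_le_pow₀ hu1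
  have hκ1 : β + (3 * β + R + (2 * β + R) / (1 - M.disc)) / (1 - M.disc) ≤ κ := by
    have e : β + (3 * β + R + (2 * β + R) / (1 - M.disc)) / (1 - M.disc) =
        β * 1 + (3 * β + R) * u + (2 * β + R) * u ^ 2 := by
      rw [hu]
      field_simp
      ring
    have h1 := mul_le_mul_of_nonneg_left hu3 hβ0
    have h2 := mul_le_mul_of_nonneg_left hu2 (show 0 ≤ 3 * β + R by positivity)
    rw [e]
    linarith
  have hκ2 : (2 * β + R) / (1 - M.disc) + R / (1 - M.disc) ≤ κ := by
    have e : (2 * β + R) / (1 - M.disc) + R / (1 - M.disc) = (2 * β + 2 * R) * u := by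
      rw [hu]
      field_simp
      ring
    have h2 := mul_le_mul_of_nonneg_left hu2 (show 0 ≤ 2 * β + 2 * R by positivity)
    have h3 : 0 ≤ β * u ^ 2 := by positivity
    rw [e]
    linarith
  set B : ℝ := 1 / ε * u * (κ ^ 4 * u ^ 3 * (1 / ε) ^ 3 * (n ^ 5 * k) + κ) with hB
  have hB0 : 0 < B := by positivity
  have heval : MvPolynomial.eval ![n, k, 1 / ε, 1 / δ, u, 1 / φ] (MvPolynomial.X 3 *
      (MvPolynomial.X 2 * MvPolynomial.X 4 * (K ^ 4 * MvPolynomial.X 4 ^ 3 *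
        MvPolynomial.X 2 ^ 3 * (MvPolynomial.X 0 ^ 5 * MvPolynomial.X 1) + K))) = 1 / δ * B := by
    have hK : MvPolynomial.eval ![n, k, 1 / ε, 1 / δ, u, 1 / φ] K = κ := by
      simp [K, hκ]
    simp only [map_mul, map_add, map_pow, hK, MvPolynomial.eval_X]
    simp [hB]
  rw [heval]
  refine (GuidedExploration.ofReal_one_sub_le_measure_card_le
    (hrun.measurableSet_mem (M.largeLoss β pG alg ε))
    (M.iterate_stepMean_nonneg alg (fun b y => Set.indicator_nonneg (fun _ _ => zero_le_one) _) ·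
      b₀ x₀)
    (hrun.measure_mem_le (M.largeLoss β pG alg ε)) (δ := δ) (m := 1 / δ * B) (by positivity)
    fun T => ?_).trans (measure_mono ?_)
  · rw [← mul_assoc, mul_one_div_cancel hδ.ne', one_mul]
    exact M.sum_iterate_stepMean_largeLoss_le halg hR hβpG hε hκ0 hκ1 hκ2 b₀ x₀ T
  · rintro ω ⟨bad, hcard, hbad⟩
    refine ⟨bad, hcard, fun t ht => ?_⟩
    have h1 := hbad t ht
    simp only [GuidedExploration.Model.largeLoss, Set.mem_ofPred_eq, not_lt] at h1
    have h2 := M.bayesValue_le_guidedValue hR hopt (M.beliefAt alg b₀ (fun s => x s ω) t) (x t ω)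
    linarith
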